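/- Let $S^2(\mathbb{C}^3)_0$ be the real vector space of symmetric traceless complex $3\times 3$ matrices, on which $(e^{i\theta},R)\in U(1)\times SO(3)$ acts by $A\mapsto e^{i\theta}RAR^{-1}$, with the $SO(3)$-invariant inner product $\langle A,B\rangle=\operatorname{Re}\operatorname{Tr}(A^*B)$. For $\mathbf{w}\in\mathbb{R}^3$ let $\widehat{\mathbf{w}}$ be the skew-symmetric matrix with $\widehat{\mathbf{w}}\mathbf{u}=\mathbf{w}\times\mathbf{u}$. Let $\gamma_1,\gamma_2,\gamma_3>0$, $\Gamma=\operatorname{diag}(\gamma_1,\gamma_1,\gamma_1+\gamma_2+\gamma_3)$, and $$J_{ab}(A)=\operatorname{Re}\operatorname{Tr}\big(\Gamma[\widehat{\mathbf{e}}_a,A]^*[\widehat{\mathbf{e}}_b,A]\big),\quad 1\le a,b\le 3 .$$ Fix a sign and let $$A_0=A_0^{\pm}=\begin{pmatrix}0&1&\pm i\\1&0&0\\ \pm i&0&0\end{pmatrix},$$ and let $\operatorname{Orb}(A_0)$ be its $U(1)\times SO(3)$-orbit (the $\Omega_8$-phase). Let $SO(3)\ltimes S^2(\mathbb{C}^3)_0$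 act on the dual of its Lie algebra, $\mathbb{R}^3\times S^2(\mathbb{C}^3)_0$, by the coadjoint action $(R,B)\cdot(\mathbf{m},A)=(R\mathbf{m}+B\diamond RAR^{-1},\,RAR^{-1})$, where $\langle B\diamond A,\mathbf{w}\rangle=\langle A,[\widehat{\mathbf{w}},B]\rangle$, and consider the Lie-Poisson bracket $$\{f,g\}(\mathbf{m},A)=\mathbf{m}\cdot\Big(\frac{\partial f}{\partial\mathbf{m}}\times\frac{\partial g}{\partial\mathbf{m}}\Big)+\Big\langle\frac{\partial f}{\partial A},\Big[\widehat{\frac{\partial g}{\partial\mathbf{m}}},A\Big]\Big\rangle-\Big\langle\frac{\partial g}{\partial A},\Big[\widehat{\frac{\partial f}{\partial\mathbf{m}}},A\Big]\Big\rangle .$$ Then: 1. $R\mapsto RA_0R^{-1}$ is a diffeomorphism from $SO(3)$ onto $\operatorname{Orb}(A_0)$. 2. For every $\boldsymbol{\mu}\in\mathbb{R}^3$ the coadjoint orbit $\mathcal{O}$ through $(\boldsymbol{\mu},A_0)$ equals $\mathbb{R}^3\times\operatorname{Orb}(A_0)$ and is a six-dimensional submanifold of $\mathbb{R}^3\times S^2(\mathbb{C}^3)_0$.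 3. $J(A)$ is invertible for every $A\in\operatorname{Orb}(A_0)$, and the three functions $$h(\mathbf{m},A)=\tfrac14\mathbf{m}^\top J(A)^{-1}\mathbf{m},\qquad j_m(\mathbf{m},A)=2\big\langle[\widehat{\mathbf{w}},A]\Gamma,\,iA\big\rangle\ \text{ with }\ \mathbf{w}=\tfrac12J(A)^{-1}\mathbf{m},\qquad \mathbf{J}_3(\mathbf{m},A)=\mathbf{e}_3\cdot\mathbf{m}$$ form a completely integrable system on $\mathcal{O}$: they are smooth on a neighbourhood of $\mathcal{O}$, they pairwise Poisson commute on $\mathcal{O}$, and the differentials of their restrictions to $\mathcal{O}$ are linearly independent except on a set of measure zero in $\mathcal{O}$. -/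

import Mathlib

open scoped Matrix ContDiff Topology

/- Norms on matrices and on spaces of matrices: only the induced (finite-dimensional) topology and
differential calculus are used, and these do not depend on the choice. -/
attribute [local instance] Matrix.normedAddCommGroup Matrix.normedSpace

noncomputable section

namespace NeutronStar

/-! ### Smooth maps between subsets of normed spaces, embedded submanifolds, null sets -/

section Smooth

variable {E F : Type*} [NormedAddCommGroup E] [NormedSpace ℝ E]
  [NormedAddCommGroup F] [NormedSpace ℝ F]

/-- `f` is smooth on the (arbitrary) subset `X`: near every point of `X` it agrees on `X` with a
smooth map defined on an open subset of the ambient space. -/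
def SmoothOnSubset (f : E → F) (X : Set E) : Prop :=
  ∀ x ∈ X, ∃ U : Set E, IsOpen U ∧ x ∈ U ∧
    ∃ g : E → F, ContDiffOn ℝ ∞ g U ∧ Set.EqOn g f (U ∩ X)

/-- `f` restricts to a diffeomorphism from the subset `X` onto the subset `Y`. -/
def IsDiffeoOn (f : E → F) (X : Set E) (Y : Set F) : Prop :=
  Set.BijOn f X Y ∧ SmoothOnSubset f X ∧
    ∃ g : F → E, Set.LeftInvOn g f X ∧ SmoothOnSubset g Y

/-- `φ` is a (smooth, regular) local parametrization of the subset `X`, with domain the open set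
`V ⊆ ℝᵏ`: a diffeomorphism from `V` onto a relatively open subset of `X`. -/
def IsLocalParam {k : ℕ} (X : Set E) (V : Set (Fin k → ℝ)) (φ : (Fin k → ℝ) → E) : Prop :=
  IsOpen V ∧ (∃ U : Set E, IsOpen U ∧ φ '' V = U ∩ X) ∧ IsDiffeoOn φ V (φ '' V)

/-- `X` is an embedded smooth `k`-dimensional submanifold of the ambient space. -/
def IsSmoothSubmanifold (k : ℕ) (X : Set E) : Prop :=
  ∀ x ∈ X, ∃ (V : Set (Fin k → ℝ)) (φ : (Fin k → ℝ) → E), IsLocalParam X V φ ∧ x ∈ φ '' V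

end Smooth

/-! ### Order parameters and the group actions -/

/-- `SO(3)`. -/
abbrev SO3 : Type := Matrix.specialOrthogonalGroup (Fin 3) ℝ

/-- A real `3 × 3` matrix regarded as a complex one. -/
def toC (R : Matrix (Fin 3) (Fin 3) ℝ) : Matrix (Fin 3) (Fin 3) ℂ := R.map Complex.ofReal

/-- The space `S²(ℂ³)₀` of symmetric traceless complex `3 × 3` matrices, as a real vector space. -/
def OrderParam : Submodule ℝ (Matrix (Fin 3) (Fin 3) ℂ) where
  carrier := {A | Aᵀ = A ∧ A.trace = 0}
  add_mem' := by
    rintro A B ⟨hA, hA'⟩ ⟨hB, hB'⟩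
    exact ⟨by rw [Matrix.transpose_add, hA, hB], by rw [Matrix.trace_add, hA', hB', add_zero]⟩
  zero_mem' := ⟨Matrix.transpose_zero, Matrix.trace_zero _ _⟩
  smul_mem' := by
    rintro c A ⟨hA, hA'⟩
    exact ⟨by rw [Matrix.transpose_smul, hA], by rw [Matrix.trace_smul, hA', smul_zero]⟩

theorem toC_transpose_mul (R : SO3) : (toC R.1)ᵀ * toC R.1 = 1 := by
  have h : R.1ᵀ * R.1 = 1 :=
    (Matrix.mem_orthogonalGroup_iff' (Fin 3) ℝ).1 (Matrix.mem_specialOrthogonalGroup_iff.1 R.2).1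
  have h2 : (toC R.1)ᵀ * toC R.1 = Complex.ofRealHom.mapMatrix (R.1ᵀ * R.1) := by
    rw [map_mul]
    rfl
  rw [h2, h, map_one]

/-- The action `A ↦ R A R⁻¹` of `SO(3)` on order parameters (`R⁻¹ = Rᵀ`). -/
def rotate (R : SO3) (A : OrderParam) : OrderParam :=
  ⟨toC R.1 * A.1 * (toC R.1)ᵀ, by
    refine ⟨by simp [Matrix.transpose_mul, A.2.1, Matrix.mul_assoc], ?_⟩
    rw [Matrix.trace_mul_comm, ← Matrix.mul_assoc, toC_transpose_mul, Matrix.one_mul]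
    exact A.2.2⟩

/-- The action `A ↦ e^{iθ} A` of `U(1)` on order parameters. -/
def phaseShift (θ : ℝ) (A : OrderParam) : OrderParam :=
  ⟨Complex.exp (θ * Complex.I) • A.1, by
    refine ⟨by rw [Matrix.transpose_smul, A.2.1], by rw [Matrix.trace_smul, A.2.2, smul_zero]⟩⟩

/-- The orbit `{e^{iθ} R A R⁻¹}` of `U(1) × SO(3)` through `A`. -/
def phaseOrbit (A : OrderParam) : Set OrderParam :=
  {B | ∃ (θ : ℝ) (R : SO3), B = phaseShift θ (rotate R A)}

/-- The base points `A₀^±` of the `Ω₈`-phase (`ε = 1` for `A₀⁺` and `ε = -1` for `A₀⁻`). -/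
def omega8 (ε : ℝ) : OrderParam :=
  ⟨!![0, 1, ε * Complex.I; 1, 0, 0; ε * Complex.I, 0, 0], by
    refine ⟨?_, by simp [Matrix.trace_fin_three]⟩
    ext i j
    fin_cases i <;> fin_cases j <;> rfl⟩

/-! ### The coadjoint action of the semidirect product `SO(3) ⋉ S²(ℂ³)₀` and its bracket -/

/-- The skew-symmetric matrix `ŵ` with `ŵ u = w × u`; this identifies `ℝ³` with `𝔰𝔬(3)`. -/
def hat (w : Fin 3 → ℝ) : Matrix (Fin 3) (Fin 3) ℝ :=
  !![0, -w 2, w 1; w 2, 0, -w 0; -w 1, w 0, 0]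

theorem hat_transpose (w : Fin 3 → ℝ) : (toC (hat w))ᵀ = -toC (hat w) := by
  ext i j
  fin_cases i <;> fin_cases j <;> simp [toC, hat]

/-- The infinitesimal action `[ŵ, A] = ŵ A - A ŵ` of `w ∈ 𝔰𝔬(3)` on order parameters. -/
def infRotate (w : Fin 3 → ℝ) (A : OrderParam) : OrderParam :=
  ⟨toC (hat w) * A.1 - A.1 * toC (hat w), by
    refine ⟨?_, by rw [Matrix.trace_sub, Matrix.trace_mul_comm, sub_self]⟩
    rw [Matrix.transpose_sub, Matrix.transpose_mul, Matrix.transpose_mul, hat_transpose, A.2.1]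
    simp only [Matrix.mul_neg, Matrix.neg_mul]
    abel⟩

/-- The duality pairing `⟨A, B⟩ = Re Tr(A* B)`; it is invariant under `SO(3)` and identifies
`S²(ℂ³)₀` with its dual. -/
def pairing (A B : Matrix (Fin 3) (Fin 3) ℂ) : ℝ := (Aᴴ * B).trace.re

/-- The diamond operation `B ⋄ A ∈ 𝔰𝔬(3)* = ℝ³`, given by `⟨B ⋄ A, w⟩ = ⟨A, [ŵ, B]⟩`. -/
def diamond (B A : OrderParam) : Fin 3 → ℝ :=
  fun a => pairing A.1 (infRotate (Pi.single a 1) B).1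

/-- The dual of the Lie algebra of `SO(3) ⋉ S²(ℂ³)₀`; its points are the pairs `(m, A)`. -/
abbrev Phase : Type := (Fin 3 → ℝ) × OrderParam

/-- The coadjoint action of `(R, B) ∈ SO(3) ⋉ S²(ℂ³)₀`,
`Ad*_{(R,B)⁻¹} (m, A) = (R m + B ⋄ (R A R⁻¹), R A R⁻¹)`. -/
def coadjoint (R : SO3) (B : OrderParam) (p : Phase) : Phase :=
  (R.1 *ᵥ p.1 + diamond B (rotate R p.2), rotate R p.2)

/-- The coadjoint orbit through `p`. -/
def coadjointOrbit (p : Phase) : Set Phase :=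
  {q | ∃ (R : SO3) (B : OrderParam), q = coadjoint R B p}

/-- The partial derivative `∂f/∂m ∈ ℝ³` at `p`. -/
def gradM (f : Phase → ℝ) (p : Phase) : Fin 3 → ℝ :=
  fun a => fderiv ℝ f p (Pi.single a 1, 0)

/-- The Lie-Poisson bracket
`{f, g}(m, A) = m ⬝ (∂f/∂m × ∂g/∂m) + ⟨∂f/∂A, [∂g/∂m, A]⟩ - ⟨∂g/∂A, [∂f/∂m, A]⟩`,
where `⟨∂f/∂A, X⟩` is the derivative of `f` at `(m, A)` in the direction `(0, X)`. -/
def bracket (f g : Phase → ℝ) (p : Phase) : ℝ :=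
  p.1 ⬝ᵥ (gradM f p ⨯₃ gradM g p)
    + fderiv ℝ f p (0, infRotate (gradM g p) p.2)
    - fderiv ℝ g p (0, infRotate (gradM f p) p.2)

/-- The functions `f₁, …, fₙ` form a completely integrable system on the coadjoint orbit `O`
(with its orbit symplectic structure, whose Poisson bracket is the restriction of the Lie-Poisson
bracket): `O` is a manifold of dimension `2n`, the functions are smooth, they Poisson commute on
`O`, and the differentials of their restrictions to `O` are linearly independent except on a set
of measure zero in `O`. The last condition is expressed in local coordinates `φ` of `O`. -/
structure IsCompletelyIntegrable {n : ℕ} (O : Set Phase) (f : Fin n → Phase → ℝ) : Prop where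
  orbit : ∃ p, O = coadjointOrbit p
  dim : IsSmoothSubmanifold (2 * n) O
  smooth : ∃ U : Set Phase, IsOpen U ∧ O ⊆ U ∧ ∀ i, ContDiffOn ℝ ∞ (f i) U
  involution : ∀ i j, ∀ p ∈ O, bracket (f i) (f j) p = 0
  independent : ∀ (V : Set (Fin (2 * n) → ℝ)) (φ : (Fin (2 * n) → ℝ) → Phase),
    IsLocalParam O V φ →
      MeasureTheory.volume
        {v ∈ V | ¬ LinearIndependent ℝ (fun i => fderiv ℝ (fun u => f i (φ u)) v)} = 0

/-! ### The three integrals -/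

/-- `Γ = diag(γ₁, γ₁, γ₁ + γ₂ + γ₃)`. -/
def Gam (γ₁ γ₂ γ₃ : ℝ) : Matrix (Fin 3) (Fin 3) ℂ :=
  toC (Matrix.diagonal ![γ₁, γ₁, γ₁ + γ₂ + γ₃])

/-- The matrix `J(A)` with `J_ab(A) = Re Tr(Γ [êₐ, A]* [ê_b, A])`, so that the Lagrangian is
`l(w, A) = Re Tr(Γ [ŵ, A]* [ŵ, A]) = wᵀ J(A) w`. -/
def inertia (γ₁ γ₂ γ₃ : ℝ) (A : OrderParam) : Matrix (Fin 3) (Fin 3) ℝ :=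
  Matrix.of fun a b =>
    (Gam γ₁ γ₂ γ₃ * (infRotate (Pi.single a 1) A).1ᴴ * (infRotate (Pi.single b 1) A).1).trace.re

/-- The velocity `w = ½ J(A)⁻¹ m`, i.e. the inverse of `m = ∂l/∂w = 2 J(A) w`. -/
def velocity (γ₁ γ₂ γ₃ : ℝ) (p : Phase) : Fin 3 → ℝ :=
  (1 / 2 : ℝ) • ((inertia γ₁ γ₂ γ₃ p.2)⁻¹ *ᵥ p.1)

/-- The Hamiltonian `h(m, A) = ¼ mᵀ J(A)⁻¹ m`. -/
def hamiltonian (γ₁ γ₂ γ₃ : ℝ) (p : Phase) : ℝ :=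
  1 / 4 * (p.1 ⬝ᵥ ((inertia γ₁ γ₂ γ₃ p.2)⁻¹ *ᵥ p.1))

/-- The momentum map `j_m = 2 ⟨(∂_z A) Γ, i A⟩` of the action `A ↦ e^{iθ} A`, in the variables
`(m, A)`, where `∂_z A = [ŵ, A]` and `w = ½ J(A)⁻¹ m`. -/
def jm (γ₁ γ₂ γ₃ : ℝ) (p : Phase) : ℝ :=
  2 * pairing ((infRotate (velocity γ₁ γ₂ γ₃ p) p.2).1 * Gam γ₁ γ₂ γ₃) (Complex.I • p.2.1)

/-- `J₃(m, A) = e₃ ⬝ m`. -/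
def J3 (p : Phase) : ℝ := p.1 2

end NeutronStar

end

open NeutronStar

/-! Write A₀ = e₁uᵀ + ue₁ᵀ with u = e₂ + iεe₃. The rotation by -εθ about e₁ multiplies u by e^{iθ},
so phases act as rotations and the orbit is a single SO(3)-orbit (`phaseOrbit_omega8`). The rotation
is recovered polynomially from A = RA₀Rᵀ: Im(AA*) is ε times the hat of x = Re₁, and Ax = Re₂ +
iεRe₃ (`frame_rotate_omega8`). Injectivity of w ↦ [ŵ, A] (`eq_zero_of_infRotate_eq_zero`) makes J(A)
positive definite and, by duality, makes B ↦ B ⋄ A surjective onto ℝ³. Hence the coadjoint orbit is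
ℝ³ × Orb(A₀), a copy of T*SO(3).

On the orbit iA = [ŵ', A] with w' = -εx, so j_m = 2w'ᵀJw = -ε m·x (`jm_eq`): up to sign, the
momentum about the body axis x. Rotations about e₃ commute with Γ, hence preserve h and j_m, which
therefore commute with J₃. Phase invariance of h gives {h, j_m} = 0.

The gradients in m of the three functions are w, -εx and e₃, so the differentials are independent
wherever F = w·(x × e₃) ≠ 0. F is linear in m, and its m-derivative vanishes only where x is
parallel to e₃; there the coordinate x₀ vanishes with nonzero differential. The bad set thus lies in
the regular parts of two zero sets, each null by Fubini (`volume_zeros_fderiv_ne_zero`). -/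

namespace NeutronStar

/-! ### Null sets: regular zeros of a differentiable function -/

section Regular

open MeasureTheory

/-- The regular part of the zero set of a differentiable function on an open subset of `ℝᵏ` is a
null set. -/
theorem volume_zeros_fderiv_ne_zero {k : ℕ} {V : Set (Fin k → ℝ)} (hV : IsOpen V)
    {g : (Fin k → ℝ) → ℝ} (hg : ∀ v ∈ V, DifferentiableAt ℝ g v) :
    volume {v ∈ V | g v = 0 ∧ fderiv ℝ g v ≠ 0} = 0 := by
  have hsub : {v ∈ V | g v = 0 ∧ fderiv ℝ g v ≠ 0} ⊆
      ⋃ i : Fin k, {v ∈ V | g v = 0 ∧ fderiv ℝ g v (Pi.single i 1) ≠ 0} := by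
    rintro v ⟨hv, h0, h1⟩
    by_contra h
    apply h1
    simp only [Set.mem_iUnion, not_exists] at h
    have h' : ∀ i, fderiv ℝ g v (Pi.single i 1) = 0 := fun i => by
      by_contra hi
      exact h i ⟨hv, h0, hi⟩
    ext w
    rw [pi_eq_sum_univ' w]
    simp [h']
  refine measure_mono_null hsub (measure_iUnion_null fun i => ?_)
  set S := {v ∈ V | g v = 0 ∧ fderiv ℝ g v (Pi.single i 1) ≠ 0} with hS
  have hmeas : MeasurableSet S := by
    have hc : ContinuousOn g V := fun v hv => (hg v hv).continuousAt.continuousWithinAt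
    have h1 : MeasurableSet (V ∩ g ⁻¹' {0}ᶜ) :=
      (hc.isOpen_inter_preimage hV isOpen_compl_singleton).measurableSet
    have h2 : MeasurableSet {v | fderiv ℝ g v (Pi.single i 1) ≠ 0} :=
      (measurable_fderiv_apply_const ℝ g _) (measurableSet_singleton 0).compl
    have : S = (V \ (V ∩ g ⁻¹' {0}ᶜ)) ∩ {v | fderiv ℝ g v (Pi.single i 1) ≠ 0} := by
      ext v
      simp only [hS, Set.mem_ofPred_eq, Set.mem_inter_iff, Set.mem_sdiff, Set.mem_preimage,
        Set.mem_compl_iff, Set.mem_singleton_iff]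
      tauto
    rw [this]
    exact (hV.measurableSet.diff h1).inter h2
  -- Fubini: it suffices that every line parallel to the i-th axis meets S in a null set.
  have key : ∀ᵐ v ∂(volume : Measure (Fin k → ℝ)), v ∈ Sᶜ := by
    refine ae_mem_of_ae_add_linearMap_mem
      (LinearMap.toSpanSingleton ℝ (Fin k → ℝ) (Pi.single i 1)) volume volume hmeas.compl
      fun y => ?_
    set T := {t : ℝ | y + t • (Pi.single i 1 : Fin k → ℝ) ∈ S}
    -- On such a line, zeros with nonzero derivative are isolated, so they form a discrete, hence
    -- countable, subset of ℝ.
    have hT : T.Countable := by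
      have : DiscreteTopology T := by
        refine discreteTopology_subtype_iff.2 fun t ht => ?_
        obtain ⟨hv, h0, h1⟩ := ht
        have hd : HasDerivAt (fun s : ℝ => g (y + s • (Pi.single i 1 : Fin k → ℝ)))
            (fderiv ℝ g (y + t • (Pi.single i 1 : Fin k → ℝ)) (Pi.single i 1)) t := by
          refine (hg _ hv).hasFDerivAt.comp_hasDerivAt t ?_
          simpa using ((hasDerivAt_id t).smul_const (Pi.single i 1 : Fin k → ℝ)).const_add y
        have hne := hd.eventually_ne (c := 0) h1
        rw [← disjoint_iff, Filter.disjoint_principal_right]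
        filter_upwards [hne] with s hs hs'
        exact hs hs'.2.1
      exact Set.countable_coe_iff.1 (TopologicalSpace.separableSpace_iff_countable.1 inferInstance)
    have := hT.ae_notMem volume
    filter_upwards [this] with t ht
    exact ht
  rw [← compl_compl S]
  exact key

end Regular

/-! ### Tangent vectors and local parametrizations -/

section Lift

variable {E F : Type*} [NormedAddCommGroup E] [NormedSpace ℝ E]
  [NormedAddCommGroup F] [NormedSpace ℝ F]

theorem IsLocalParam.differentiableAt {k : ℕ} {X : Set E} {V : Set (Fin k → ℝ)}
    {φ : (Fin k → ℝ) → E} (h : IsLocalParam X V φ) {v : Fin k → ℝ} (hv : v ∈ V) :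
    DifferentiableAt ℝ φ v := by
  obtain ⟨U, hU, hvU, g, hg, hgφ⟩ := h.2.2.2.1 v hv
  have h1 : g =ᶠ[𝓝 v] φ := by
    filter_upwards [(hU.inter h.1).mem_nhds ⟨hvU, hv⟩] with u hu using hgφ hu
  exact ((hg.contDiffAt (hU.mem_nhds hvU)).differentiableAt (by simp)).congr_of_eventuallyEq
    h1.symm

theorem IsLocalParam.mem {k : ℕ} {X : Set E} {V : Set (Fin k → ℝ)}
    {φ : (Fin k → ℝ) → E} (h : IsLocalParam X V φ) {v : Fin k → ℝ} (hv : v ∈ V) : φ v ∈ X := by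
  obtain ⟨U, -, hU⟩ := h.2.1
  exact (hU ▸ Set.mem_image_of_mem φ hv).2

/-- Velocities of curves in `X` lie in the range of the differential of a local parametrization. -/
theorem IsLocalParam.exists_fderiv_eq {k : ℕ} {X : Set E} {V : Set (Fin k → ℝ)}
    {φ : (Fin k → ℝ) → E} (h : IsLocalParam X V φ) {v : Fin k → ℝ} (hv : v ∈ V)
    {c : ℝ → E} {τ : E} (hc : HasDerivAt c τ 0) (hc0 : c 0 = φ v) (hcX : ∀ t, c t ∈ X) :
    ∃ ξ, fderiv ℝ φ v ξ = τ := by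
  have hd := (h.differentiableAt hv).hasFDerivAt
  obtain ⟨-, ⟨U, hU, hUX⟩, -, -, g, hgl, hg⟩ := h
  obtain ⟨W, hW, hvW, G, hG, hGg⟩ := hg (φ v) (Set.mem_image_of_mem φ hv)
  have hGd : DifferentiableAt ℝ G (φ v) :=
    (hG.contDiffAt (hW.mem_nhds hvW)).differentiableAt (by simp)
  have hvU : φ v ∈ U := (hUX ▸ Set.mem_image_of_mem φ hv).1
  have hev : ∀ᶠ t in 𝓝 (0 : ℝ), c t ∈ U ∩ W :=
    hc.continuousAt (by rw [hc0]; exact (hU.inter hW).mem_nhds ⟨hvU, hvW⟩)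
  have hG0 : G (φ v) = v := by
    rw [hGg ⟨hvW, Set.mem_image_of_mem φ hv⟩, hgl hv]
  -- Near 0 the curve is φ of its coordinate expression G ∘ c; differentiating this identity
  -- exhibits τ in the range of the differential.
  have heq : (fun t => φ (G (c t))) =ᶠ[𝓝 0] c := by
    filter_upwards [hev] with t ht
    have h1 : c t ∈ φ '' V := hUX ▸ ⟨ht.1, hcX t⟩
    have h2 : G (c t) = g (c t) := hGg ⟨ht.2, h1⟩
    obtain ⟨u, hu, huc⟩ := h1
    rw [h2, ← huc, hgl hu]
  have hd1 : HasDerivAt (fun t => G (c t)) (fderiv ℝ G (φ v) τ) 0 :=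
    HasFDerivAt.comp_hasDerivAt (0 : ℝ) (by rw [hc0]; exact hGd.hasFDerivAt) hc
  have hd2 : HasDerivAt (fun t => φ (G (c t))) (fderiv ℝ φ v (fderiv ℝ G (φ v) τ)) 0 :=
    HasFDerivAt.comp_hasDerivAt (0 : ℝ) (by rw [hc0, hG0]; exact hd) hd1
  exact ⟨_, hd2.unique (hc.congr_of_eventuallyEq heq)⟩

/-- Evaluates directional derivatives along curves that stay in the orbit, where the integrals have
simple closed forms that may fail off it. -/
theorem fderiv_eq_of_hasDerivAt_comp {f : E → F} {c : ℝ → E} {p τ : E} {d : F}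
    (hf : DifferentiableAt ℝ f p) (hc : HasDerivAt c τ 0) (hc0 : c 0 = p)
    (hd : HasDerivAt (fun t => f (c t)) d 0) : fderiv ℝ f p τ = d := by
  subst hc0
  exact (hf.hasFDerivAt.comp_hasDerivAt (0 : ℝ) hc).unique hd

end Lift

/-! ### Differential calculus of matrix-valued maps -/

section MatrixCalculus

variable {E : Type*} [NormedAddCommGroup E] [NormedSpace ℝ E] {m n l : ℕ}

theorem contDiffOn_matrix {K : Type*} [NormedAddCommGroup K] [NormedSpace ℝ K]
    {f : E → Matrix (Fin m) (Fin n) K} {s : Set E}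
    (h : ∀ i j, ContDiffOn ℝ ∞ (fun x => f x i j) s) : ContDiffOn ℝ ∞ f s :=
  contDiffOn_pi.2 fun i => contDiffOn_pi.2 fun j => h i j

theorem ContDiffOn.entry {K : Type*} [NormedAddCommGroup K] [NormedSpace ℝ K]
    {f : E → Matrix (Fin m) (Fin n) K} {s : Set E} (h : ContDiffOn ℝ ∞ f s) (i : Fin m)
    (j : Fin n) : ContDiffOn ℝ ∞ (fun x => f x i j) s :=
  contDiffOn_pi.1 (contDiffOn_pi.1 h i) j

theorem hasDerivAt_matrix {K : Type*} [NormedAddCommGroup K] [NormedSpace ℝ K]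
    {f : ℝ → Matrix (Fin m) (Fin n) K} {f' : Matrix (Fin m) (Fin n) K} {t : ℝ} :
    HasDerivAt f f' t ↔ ∀ i j, HasDerivAt (fun x => f x i j) (f' i j) t :=
  hasDerivAt_pi.trans (forall_congr' fun _ => hasDerivAt_pi)

variable {K : Type*} [RCLike K]

theorem ContDiffOn.matrix_mul {f : E → Matrix (Fin m) (Fin n) K}
    {g : E → Matrix (Fin n) (Fin l) K} {s : Set E} (hf : ContDiffOn ℝ ∞ f s)
    (hg : ContDiffOn ℝ ∞ g s) : ContDiffOn ℝ ∞ (fun x => f x * g x) s := by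
  refine contDiffOn_matrix fun i j => ?_
  simp only [Matrix.mul_apply]
  exact ContDiffOn.sum fun k _ => (hf.entry i k).mul (hg.entry k j)

theorem ContDiffOn.matrix_mulVec {f : E → Matrix (Fin m) (Fin n) K}
    {g : E → Fin n → K} {s : Set E} (hf : ContDiffOn ℝ ∞ f s)
    (hg : ContDiffOn ℝ ∞ g s) : ContDiffOn ℝ ∞ (fun x => f x *ᵥ g x) s := by
  refine contDiffOn_pi.2 fun i => ?_
  simp only [Matrix.mulVec, dotProduct]
  exact ContDiffOn.sum fun k _ => (hf.entry i k).mul (contDiffOn_pi.1 hg k)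

theorem ContDiffOn.dotProduct {f g : E → Fin n → K} {s : Set E} (hf : ContDiffOn ℝ ∞ f s)
    (hg : ContDiffOn ℝ ∞ g s) : ContDiffOn ℝ ∞ (fun x => f x ⬝ᵥ g x) s :=
  ContDiffOn.sum fun k _ => (contDiffOn_pi.1 hf k).mul (contDiffOn_pi.1 hg k)

theorem ContDiffOn.matrix_transpose {f : E → Matrix (Fin m) (Fin n) K} {s : Set E}
    (hf : ContDiffOn ℝ ∞ f s) : ContDiffOn ℝ ∞ (fun x => (f x)ᵀ) s :=
  contDiffOn_matrix fun i j => hf.entry j i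

theorem ContDiffOn.matrix_conjTranspose {f : E → Matrix (Fin m) (Fin n) ℂ} {s : Set E}
    (hf : ContDiffOn ℝ ∞ f s) : ContDiffOn ℝ ∞ (fun x => (f x)ᴴ) s :=
  contDiffOn_matrix fun i j => Complex.conjCLE.contDiff.comp_contDiffOn (hf.entry j i)

theorem ContDiffOn.matrix_inv {f : E → Matrix (Fin 3) (Fin 3) ℝ} {s : Set E}
    (hf : ContDiffOn ℝ ∞ f s) (h0 : ∀ x ∈ s, (f x).det ≠ 0) :
    ContDiffOn ℝ ∞ (fun x => (f x)⁻¹) s := by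
  have e := hf.entry
  have hdet : ContDiffOn ℝ ∞ (fun x => (f x).det) s := by
    simp only [Matrix.det_fin_three]
    fun_prop
  simp only [Matrix.inv_def, Ring.inverse_eq_inv']
  refine contDiffOn_matrix fun i j => ?_
  simp only [Matrix.smul_apply, smul_eq_mul]
  refine (hdet.inv h0).mul ?_
  simp only [Matrix.adjugate_fin_three]
  fin_cases i <;> fin_cases j <;> simp <;> fun_prop

theorem HasDerivAt.matrix_mul {f : ℝ → Matrix (Fin m) (Fin n) K}
    {g : ℝ → Matrix (Fin n) (Fin l) K} {f' : Matrix (Fin m) (Fin n) K}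
    {g' : Matrix (Fin n) (Fin l) K} {t : ℝ}
    (hf : HasDerivAt f f' t) (hg : HasDerivAt g g' t) :
    HasDerivAt (fun x => f x * g x) (f' * g t + f t * g') t := by
  refine hasDerivAt_matrix.2 fun i j => ?_
  simp only [Matrix.mul_apply, Matrix.add_apply, ← Finset.sum_add_distrib]
  exact HasDerivAt.fun_sum fun k _ => (hasDerivAt_matrix.1 hf i k).mul (hasDerivAt_matrix.1 hg k j)

theorem HasDerivAt.matrix_transpose {f : ℝ → Matrix (Fin m) (Fin n) K}
    {f' : Matrix (Fin m) (Fin n) K} {t : ℝ} (hf : HasDerivAt f f' t) :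
    HasDerivAt (fun x => (f x)ᵀ) f'ᵀ t :=
  hasDerivAt_matrix.2 fun i j => hasDerivAt_matrix.1 hf j i

theorem HasDerivAt.toC {f : ℝ → Matrix (Fin 3) (Fin 3) ℝ}
    {f' : Matrix (Fin 3) (Fin 3) ℝ} {t : ℝ} (hf : HasDerivAt f f' t) :
    HasDerivAt (fun x => toC (f x)) (toC f') t :=
  hasDerivAt_matrix.2 fun i j => (hasDerivAt_matrix.1 hf i j).ofReal_comp

theorem ContDiffOn.toC {f : E → Matrix (Fin 3) (Fin 3) ℝ} {s : Set E}
    (hf : ContDiffOn ℝ ∞ f s) : ContDiffOn ℝ ∞ (fun x => toC (f x)) s :=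
  contDiffOn_matrix fun i j => Complex.ofRealCLM.contDiff.comp_contDiffOn (hf.entry i j)

/-- Conjugation by a matrix outside SO(3) need not preserve trace zero; P brings the result back, so
`rotate` extends smoothly to all matrices. -/
theorem exists_projection : ∃ P : Matrix (Fin 3) (Fin 3) ℂ →ₗ[ℝ] OrderParam,
    ContDiff ℝ ∞ P ∧ ∀ A : OrderParam, P A.1 = A := by
  obtain ⟨P, hP⟩ := OrderParam.subtype.exists_leftInverse_of_injective (by simp)
  exact ⟨P, P.toContinuousLinearMap.contDiff, fun A => LinearMap.congr_fun hP A⟩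

theorem hasDerivAt_orderParam {c : ℝ → OrderParam} {X : OrderParam} {t : ℝ}
    (h : HasDerivAt (fun s => (c s).1) X.1 t) : HasDerivAt c X t := by
  have h' := (hasDerivAt_iff_isLittleO.1 h).norm_left
  exact hasDerivAt_iff_isLittleO.2 (Asymptotics.IsLittleO.of_norm_left h')

theorem contDiff_coe_orderParam : ContDiff ℝ ∞ (fun A : OrderParam => A.1) :=
  OrderParam.subtypeL.contDiff

end MatrixCalculus

/-! ### Algebra of the actions on the Ω₈ orbit -/

section Algebra

theorem toC_mul (M N : Matrix (Fin 3) (Fin 3) ℝ) : toC (M * N) = toC M * toC N :=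
  map_mul Complex.ofRealHom.mapMatrix M N

theorem toC_one : toC 1 = 1 := map_one Complex.ofRealHom.mapMatrix

theorem toC_transpose (M : Matrix (Fin 3) (Fin 3) ℝ) : toC Mᵀ = (toC M)ᵀ := rfl

theorem toC_conjTranspose (M : Matrix (Fin 3) (Fin 3) ℝ) : (toC M)ᴴ = (toC M)ᵀ := by
  ext i j
  simp [toC]

theorem transpose_mul_self (R : SO3) : R.1ᵀ * R.1 = 1 :=
  (Matrix.mem_orthogonalGroup_iff' (Fin 3) ℝ).1 (Matrix.mem_specialOrthogonalGroup_iff.1 R.2).1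

theorem mul_transpose_self (R : SO3) : R.1 * R.1ᵀ = 1 :=
  (Matrix.mem_orthogonalGroup_iff (Fin 3) ℝ).1 (Matrix.mem_specialOrthogonalGroup_iff.1 R.2).1

theorem transpose_eq_adjugate (R : SO3) : R.1ᵀ = R.1.adjugate := by
  have hd : R.1.det = 1 := (Matrix.mem_specialOrthogonalGroup_iff.1 R.2).2
  calc R.1ᵀ = (R.1.adjugate * R.1) * R.1ᵀ := by rw [Matrix.adjugate_mul, hd, one_smul, one_mul]
    _ = R.1.adjugate := by rw [mul_assoc, mul_transpose_self, mul_one]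

/-- For a rotation, transpose, inverse and adjugate coincide. These quadratic relations feed the
`linear_combination` calls below. -/
theorem cofactors (R : SO3) :
    (R.1 0 0 = R.1 1 1 * R.1 2 2 - R.1 1 2 * R.1 2 1 ∧
     R.1 0 1 = R.1 1 2 * R.1 2 0 - R.1 1 0 * R.1 2 2 ∧
     R.1 0 2 = R.1 1 0 * R.1 2 1 - R.1 1 1 * R.1 2 0) ∧
    (R.1 1 0 = R.1 0 2 * R.1 2 1 - R.1 0 1 * R.1 2 2 ∧
     R.1 1 1 = R.1 0 0 * R.1 2 2 - R.1 0 2 * R.1 2 0 ∧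
     R.1 1 2 = R.1 0 1 * R.1 2 0 - R.1 0 0 * R.1 2 1) ∧
    (R.1 2 0 = R.1 0 1 * R.1 1 2 - R.1 0 2 * R.1 1 1 ∧
     R.1 2 1 = R.1 0 2 * R.1 1 0 - R.1 0 0 * R.1 1 2 ∧
     R.1 2 2 = R.1 0 0 * R.1 1 1 - R.1 0 1 * R.1 1 0) := by
  have h := fun i j => congrFun (congrFun (transpose_eq_adjugate R) j) i
  simp only [Matrix.adjugate_fin_three, Matrix.transpose_apply] at h
  refine ⟨⟨?_, ?_, ?_⟩, ⟨?_, ?_, ?_⟩, ?_, ?_, ?_⟩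
  · rw [h 0 0]; simp
  · rw [h 0 1]; simp; ring
  · rw [h 0 2]; simp
  · rw [h 1 0]; simp; ring
  · rw [h 1 1]; simp
  · rw [h 1 2]; simp; ring
  · rw [h 2 0]; simp
  · rw [h 2 1]; simp; ring
  · rw [h 2 2]; simp

theorem rotate_mul (R S : SO3) (A : OrderParam) : rotate (R * S) A = rotate R (rotate S A) := by
  ext1
  simp only [rotate, Submonoid.coe_mul, toC_mul, Matrix.transpose_mul, mul_assoc]

theorem rotate_one (A : OrderParam) : rotate 1 A = A := by
  ext1
  simp [rotate, toC_one]

theorem mul_hat_mul_transpose (R : SO3) (w : Fin 3 → ℝ) :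
    R.1 * hat w * R.1ᵀ = hat (R.1 *ᵥ w) := by
  obtain ⟨⟨h00, h01, h02⟩, ⟨h10, h11, h12⟩, h20, h21, h22⟩ := cofactors R
  ext i j
  fin_cases i <;> fin_cases j <;>
    simp [hat, Matrix.mul_apply, Fin.sum_univ_three, Matrix.mulVec, dotProduct]
  · ring
  · linear_combination w 0 * h20 + w 1 * h21 + w 2 * h22
  · linear_combination -w 0 * h10 - w 1 * h11 - w 2 * h12
  · linear_combination -w 0 * h20 - w 1 * h21 - w 2 * h22
  · ring
  · linear_combination w 0 * h00 + w 1 * h01 + w 2 * h02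
  · linear_combination w 0 * h10 + w 1 * h11 + w 2 * h12
  · linear_combination -w 0 * h00 - w 1 * h01 - w 2 * h02
  · ring

theorem toC_hat_mulVec (R : SO3) (w : Fin 3 → ℝ) :
    toC (hat (R.1 *ᵥ w)) = toC R.1 * toC (hat w) * (toC R.1)ᵀ := by
  rw [← mul_hat_mul_transpose, toC_mul, toC_mul, toC_transpose]

theorem transpose_mul_cancel_left (R : SO3) (M : Matrix (Fin 3) (Fin 3) ℂ) :
    (toC R.1)ᵀ * (toC R.1 * M) = M := by
  rw [← mul_assoc, toC_transpose_mul, one_mul]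

theorem infRotate_rotate (R : SO3) (w : Fin 3 → ℝ) (A : OrderParam) :
    infRotate (R.1 *ᵥ w) (rotate R A) = rotate R (infRotate w A) := by
  ext1
  simp only [infRotate, rotate, toC_hat_mulVec, mul_assoc, transpose_mul_cancel_left, mul_sub,
    sub_mul]

theorem infRotate_phaseShift (θ : ℝ) (w : Fin 3 → ℝ) (A : OrderParam) :
    infRotate w (phaseShift θ A) = phaseShift θ (infRotate w A) := by
  ext1
  simp [infRotate, phaseShift, smul_sub]

theorem rotate_phaseShift (θ : ℝ) (R : SO3) (A : OrderParam) :
    rotate R (phaseShift θ A) = phaseShift θ (rotate R A) := by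
  ext1
  simp [rotate, phaseShift]

theorem toC_hat (w : Fin 3 → ℝ) :
    toC (hat w) = !![0, -(w 2 : ℂ), w 1; w 2, 0, -(w 0 : ℂ); -(w 1 : ℂ), w 0, 0] := by
  ext i j
  fin_cases i <;> fin_cases j <;> simp [toC, hat]

theorem hat_add (v w : Fin 3 → ℝ) : hat (v + w) = hat v + hat w := by
  ext i j
  fin_cases i <;> fin_cases j <;> simp [hat] <;> ring

theorem hat_smul (c : ℝ) (w : Fin 3 → ℝ) : hat (c • w) = c • hat w := by
  ext i j
  fin_cases i <;> fin_cases j <;> simp [hat]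

theorem hat_mulVec (w u : Fin 3 → ℝ) : hat w *ᵥ u = w ⨯₃ u := by
  ext i
  fin_cases i <;> simp [hat, cross_apply, Matrix.mulVec, dotProduct, Fin.sum_univ_three] <;> ring

theorem toC_add (M N : Matrix (Fin 3) (Fin 3) ℝ) : toC (M + N) = toC M + toC N :=
  map_add Complex.ofRealHom.mapMatrix M N

theorem toC_smul (c : ℝ) (M : Matrix (Fin 3) (Fin 3) ℝ) : toC (c • M) = c • toC M := by
  ext i j
  simp [toC]

/-- `infRotate` as a linear map in the angular velocity. -/
noncomputable def infRotateₗ (A : OrderParam) : (Fin 3 → ℝ) →ₗ[ℝ] Matrix (Fin 3) (Fin 3) ℂ where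
  toFun w := (infRotate w A).1
  map_add' v w := by
    simp only [infRotate, hat_add, toC_add, add_mul, mul_add]
    abel
  map_smul' c w := by
    simp only [infRotate, hat_smul, toC_smul, smul_mul_assoc, mul_smul_comm, smul_sub,
      RingHom.id_apply]

theorem infRotate_eq_sum (w : Fin 3 → ℝ) (A : OrderParam) :
    (infRotate w A).1 = ∑ a, w a • (infRotate (Pi.single a 1) A).1 := by
  have h := congrArg (infRotateₗ A) (pi_eq_sum_univ' w)
  rw [map_sum] at h
  simp only [map_smul] at h
  exact h

/-- Rotations about the first axis. -/
noncomputable def rotX (t : ℝ) : SO3 :=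
  ⟨!![1, 0, 0; 0, Real.cos t, -Real.sin t; 0, Real.sin t, Real.cos t], by
    have h := Real.sin_sq_add_cos_sq t
    rw [Matrix.mem_specialOrthogonalGroup_iff, Matrix.mem_orthogonalGroup_iff]
    refine ⟨?_, ?_⟩
    · ext i j
      fin_cases i <;> fin_cases j <;>
        simp [Matrix.mul_apply, Fin.sum_univ_three] <;> linarith
    · simp [Matrix.det_fin_three]
      linarith⟩

/-- With A₀ = e₁uᵀ + ue₁ᵀ and u = e₂ + iεe₃, rotation by α about e₁ fixes e₁ and multiplies u by
e^{-iεα}; take α = -εθ and use ε² = 1. -/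
theorem phaseShift_omega8 {ε : ℝ} (hε : ε = 1 ∨ ε = -1) (θ : ℝ) :
    phaseShift θ (omega8 ε) = rotate (rotX (-ε * θ)) (omega8 ε) := by
  ext1
  have he : Complex.exp (θ * Complex.I) = Real.cos θ + Real.sin θ * Complex.I := by
    rw [Complex.exp_mul_I, Complex.ofReal_cos, Complex.ofReal_sin]
  ext i j
  have hI := Complex.I_mul_I
  rcases hε with rfl | rfl <;> fin_cases i <;> fin_cases j <;>
    simp [phaseShift, rotate, omega8, rotX, toC, Matrix.mul_apply, Fin.sum_univ_three, he,
      -Complex.ofReal_cos, -Complex.ofReal_sin] <;>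
    first
    | ring1
    | linear_combination (Real.sin θ : ℂ) * hI
    | linear_combination -(Real.sin θ : ℂ) * hI

/-- A phase commutes with R and becomes, at A₀, a rotation absorbed on the right of R. -/
theorem phaseOrbit_omega8 {ε : ℝ} (hε : ε = 1 ∨ ε = -1) :
    phaseOrbit (omega8 ε) = Set.range fun R : SO3 => rotate R (omega8 ε) := by
  ext B
  constructor
  · rintro ⟨θ, R, rfl⟩
    refine ⟨R * rotX (-ε * θ), ?_⟩
    simp only [rotate_mul, ← phaseShift_omega8 hε, rotate_phaseShift]
  · rintro ⟨R, rfl⟩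
    refine ⟨0, R, ?_⟩
    ext1
    simp [phaseShift]

theorem rotate_mem {ε : ℝ} (hε : ε = 1 ∨ ε = -1) {A : OrderParam}
    (hA : A ∈ phaseOrbit (omega8 ε)) (R : SO3) : rotate R A ∈ phaseOrbit (omega8 ε) := by
  rw [phaseOrbit_omega8 hε] at hA ⊢
  obtain ⟨S, rfl⟩ := hA
  exact ⟨R * S, rotate_mul R S _⟩

/-- The first vector of the frame `R` with `A = R A₀ R⁻¹`. -/
noncomputable def axis (ε : ℝ) (A : OrderParam) : Fin 3 → ℝ :=
  ε • ![((A.1 * A.1ᴴ) 2 1).im, ((A.1 * A.1ᴴ) 0 2).im, ((A.1 * A.1ᴴ) 1 0).im]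

/-- The frame `R` with `A = R A₀ R⁻¹`. -/
noncomputable def frame (ε : ℝ) (A : OrderParam) : Matrix (Fin 3) (Fin 3) ℝ :=
  Matrix.of fun i => ![axis ε A i, ((A.1 *ᵥ fun k => (axis ε A k : ℂ)) i).re,
    ε * ((A.1 *ᵥ fun k => (axis ε A k : ℂ)) i).im]

/-- Im(A₀A₀*) = ε ê₁ and conjugation by R carries ê₁ to the hat of Re₁; `axis` reads off the three
entries of that hat, with ε² = 1. -/
theorem axis_rotate_omega8 {ε : ℝ} (hε : ε = 1 ∨ ε = -1) (R : SO3) :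
    axis ε (rotate R (omega8 ε)) = R.1 *ᵥ Pi.single 0 1 := by
  have h : (rotate R (omega8 ε)).1 * (rotate R (omega8 ε)).1ᴴ =
      toC R.1 * !![2, 0, 0; 0, 1, -ε * Complex.I; 0, ε * Complex.I, 1] * (toC R.1)ᵀ := by
    have h0 : (omega8 ε).1 * (omega8 ε).1ᴴ =
        !![2, 0, 0; 0, 1, -ε * Complex.I; 0, ε * Complex.I, 1] := by
      have hI := Complex.I_mul_I
      ext i j
      rcases hε with rfl | rfl <;> fin_cases i <;> fin_cases j <;>
        simp [omega8, Matrix.mul_apply, Fin.sum_univ_three] <;> norm_num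
    rw [← h0]
    simp only [rotate, Matrix.conjTranspose_mul, ← toC_transpose, toC_conjTranspose,
      Matrix.transpose_transpose, mul_assoc]
    simp only [toC_transpose, transpose_mul_cancel_left]
  obtain ⟨⟨h00, h01, h02⟩, ⟨h10, h11, h12⟩, h20, h21, h22⟩ := cofactors R
  ext i
  simp only [axis, h]
  rcases hε with rfl | rfl <;> fin_cases i <;>
    simp [Matrix.mul_apply, Fin.sum_univ_three, toC]
  · linear_combination -h00
  · linear_combination -h10
  · linear_combination -h20
  · linear_combination -h00
  · linear_combination -h10
  · linear_combination -h20

/-- Since A₀e₁ = e₂ + iεe₃, applying A to its axis gives Re₂ + iεRe₃, whose real and imaginary parts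
are the remaining columns. This is the smooth inverse of R ↦ RA₀R⁻¹. -/
theorem frame_rotate_omega8 {ε : ℝ} (hε : ε = 1 ∨ ε = -1) (R : SO3) :
    frame ε (rotate R (omega8 ε)) = R.1 := by
  have hx : (fun k => ((axis ε (rotate R (omega8 ε)) k : ℝ) : ℂ)) = toC R.1 *ᵥ Pi.single 0 1 := by
    rw [axis_rotate_omega8 hε]
    ext k
    simp [toC]
  have hu : (rotate R (omega8 ε)).1 *ᵥ (fun k => ((axis ε (rotate R (omega8 ε)) k : ℝ) : ℂ)) =
      toC R.1 *ᵥ ![0, 1, ε * Complex.I] := by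
    rw [hx]
    simp only [rotate, Matrix.mulVec_mulVec, mul_assoc, toC_transpose_mul, mul_one]
    rw [← Matrix.mulVec_mulVec]
    congr 1
    ext k
    fin_cases k <;> simp [omega8]
  ext i j
  simp only [frame, hu]
  simp only [axis_rotate_omega8 hε]
  rcases hε with rfl | rfl <;> fin_cases j <;>
    simp [toC, Matrix.mulVec, dotProduct, Fin.sum_univ_three]

theorem axis_rotate {ε : ℝ} (hε : ε = 1 ∨ ε = -1) {A : OrderParam}
    (hA : A ∈ phaseOrbit (omega8 ε)) (R : SO3) : axis ε (rotate R A) = R.1 *ᵥ axis ε A := by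
  rw [phaseOrbit_omega8 hε] at hA
  obtain ⟨S, rfl⟩ := hA
  simp only [← rotate_mul, axis_rotate_omega8 hε, Submonoid.coe_mul, Matrix.mulVec_mulVec]

theorem axis_dotProduct_self {ε : ℝ} (hε : ε = 1 ∨ ε = -1) {A : OrderParam}
    (hA : A ∈ phaseOrbit (omega8 ε)) : axis ε A ⬝ᵥ axis ε A = 1 := by
  rw [phaseOrbit_omega8 hε] at hA
  obtain ⟨S, rfl⟩ := hA
  simp only [axis_rotate_omega8 hε]
  rw [Matrix.dotProduct_mulVec, Matrix.vecMul_mulVec, transpose_mul_self]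
  simp

/-- On the orbit, the phase rotates the order parameter in the same way as a rotation about its
axis. -/
theorem infRotate_axis {ε : ℝ} (hε : ε = 1 ∨ ε = -1) {A : OrderParam}
    (hA : A ∈ phaseOrbit (omega8 ε)) :
    (infRotate (-ε • axis ε A) A).1 = Complex.I • A.1 := by
  rw [phaseOrbit_omega8 hε] at hA
  obtain ⟨S, rfl⟩ := hA
  simp only [axis_rotate_omega8 hε]
  rw [← Matrix.mulVec_smul, infRotate_rotate]
  have h0 : (infRotate (-ε • Pi.single 0 1) (omega8 ε)).1 = Complex.I • (omega8 ε).1 := by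
    ext i j
    rcases hε with rfl | rfl <;> fin_cases i <;> fin_cases j <;>
      simp [infRotate, omega8, toC_hat]
  simp only [rotate, h0, mul_smul_comm, smul_mul_assoc]

theorem eq_zero_of_infRotate_eq_zero {ε : ℝ} (hε : ε = 1 ∨ ε = -1) {A : OrderParam}
    (hA : A ∈ phaseOrbit (omega8 ε)) {w : Fin 3 → ℝ} (hw : (infRotate w A).1 = 0) : w = 0 := by
  rw [phaseOrbit_omega8 hε] at hA
  obtain ⟨S, rfl⟩ := hA
  have hw' : w = S.1 *ᵥ (S.1ᵀ *ᵥ w) := by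
    rw [Matrix.mulVec_mulVec, mul_transpose_self, Matrix.one_mulVec]
  rw [hw', infRotate_rotate] at hw
  have h1 : (infRotate (S.1ᵀ *ᵥ w) (omega8 ε)).1 = 0 := by
    have h2 := congrArg (fun M => (toC S.1)ᵀ * M * toC S.1) hw
    simpa only [rotate, mul_assoc, transpose_mul_cancel_left, toC_transpose_mul, mul_one,
      Matrix.zero_mul, Matrix.mul_zero] using h2
  have h3 : S.1ᵀ *ᵥ w = 0 := by
    generalize S.1ᵀ *ᵥ w = u at h1
    -- Entry (0,0) is -2u₂ + 2iεu₁ and entry (0,1) is -iεu₀, so these two already determine u.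
    have e00 := congrFun (congrFun h1 0) 0
    have e01 := congrFun (congrFun h1 0) 1
    rcases hε with rfl | rfl <;>
    · simp [infRotate, omega8, toC_hat,
        Complex.ext_iff] at e00 e01
      ext k
      fin_cases k <;> simp <;> linarith
  rw [hw', h3, Matrix.mulVec_zero]

end Algebra

/-! ### The inertia matrix, its symmetries and the coadjoint orbit -/

section Inertia

variable {γ₁ γ₂ γ₃ : ℝ}

theorem Gam_conjTranspose (γ₁ γ₂ γ₃ : ℝ) : (Gam γ₁ γ₂ γ₃)ᴴ = Gam γ₁ γ₂ γ₃ := by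
  rw [Gam, toC_conjTranspose, ← toC_transpose, Matrix.diagonal_transpose]

theorem dotProduct_inertia_mulVec (γ₁ γ₂ γ₃ : ℝ) (A : OrderParam) (v w : Fin 3 → ℝ) :
    v ⬝ᵥ (inertia γ₁ γ₂ γ₃ A *ᵥ w) =
      (Gam γ₁ γ₂ γ₃ * (infRotate v A).1ᴴ * (infRotate w A).1).trace.re := by
  rw [infRotate_eq_sum v, infRotate_eq_sum w]
  simp only [Matrix.conjTranspose_sum, Matrix.conjTranspose_smul, star_trivial, Finset.mul_sum,
    Finset.sum_mul, Matrix.trace_sum, Complex.re_sum, mul_smul_comm, smul_mul_assoc,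
    Matrix.trace_smul, Complex.smul_re, smul_eq_mul, dotProduct, Matrix.mulVec, inertia,
    Matrix.of_apply]
  rw [Finset.sum_comm]
  exact Finset.sum_congr rfl fun i _ => Finset.sum_congr rfl fun j _ => by ring

theorem dotProduct_inertia_mulVec_comm (γ₁ γ₂ γ₃ : ℝ) (A : OrderParam) (v w : Fin 3 → ℝ) :
    v ⬝ᵥ (inertia γ₁ γ₂ γ₃ A *ᵥ w) = w ⬝ᵥ (inertia γ₁ γ₂ γ₃ A *ᵥ v) := by
  rw [dotProduct_inertia_mulVec, dotProduct_inertia_mulVec, ← Complex.conj_re,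
    starRingEnd_apply, ← Matrix.trace_conjTranspose]
  simp only [Matrix.conjTranspose_mul, Matrix.conjTranspose_conjTranspose, Gam_conjTranspose]
  rw [← mul_assoc, Matrix.trace_mul_comm, ← mul_assoc]

theorem matrix_ext_dotProduct {M N : Matrix (Fin 3) (Fin 3) ℝ}
    (h : ∀ v w : Fin 3 → ℝ, v ⬝ᵥ (M *ᵥ w) = v ⬝ᵥ (N *ᵥ w)) : M = N := by
  ext i j
  simpa using h (Pi.single i 1) (Pi.single j 1)

theorem inertia_transpose (γ₁ γ₂ γ₃ : ℝ) (A : OrderParam) :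
    (inertia γ₁ γ₂ γ₃ A)ᵀ = inertia γ₁ γ₂ γ₃ A :=
  matrix_ext_dotProduct fun v w => by
    rw [Matrix.mulVec_transpose, dotProduct_comm, ← Matrix.dotProduct_mulVec,
      dotProduct_inertia_mulVec_comm]

theorem inv_inertia_comm (γ₁ γ₂ γ₃ : ℝ) (A : OrderParam) (v w : Fin 3 → ℝ) :
    v ⬝ᵥ ((inertia γ₁ γ₂ γ₃ A)⁻¹ *ᵥ w) = w ⬝ᵥ ((inertia γ₁ γ₂ γ₃ A)⁻¹ *ᵥ v) := by
  rw [dotProduct_comm, ← Matrix.vecMul_transpose, ← Matrix.dotProduct_mulVec,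
    Matrix.transpose_nonsing_inv, inertia_transpose]

/-- wᵀJw is the sum of the squared column norms of [ŵ, A] weighted by the positive entries of Γ, so
Jw = 0 forces [ŵ, A] = 0. The weak inequality on γ₂ + γ₃ admits Γ = 1, which `exists_diamond_eq`
needs. -/
theorem inertia_det_isUnit {ε : ℝ} (hε : ε = 1 ∨ ε = -1) (h₁ : 0 < γ₁) (h₂₃ : 0 ≤ γ₂ + γ₃)
    {A : OrderParam} (hA : A ∈ phaseOrbit (omega8 ε)) : IsUnit (inertia γ₁ γ₂ γ₃ A).det := by
  rw [← Matrix.isUnit_iff_isUnit_det, ← Matrix.mulVec_injective_iff_isUnit]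
  rw [← Matrix.coe_mulVecLin, injective_iff_map_eq_zero]
  intro w hw
  rw [Matrix.mulVecLin_apply] at hw
  have h0 := dotProduct_inertia_mulVec γ₁ γ₂ γ₃ A w w
  rw [hw, dotProduct_zero] at h0
  refine eq_zero_of_infRotate_eq_zero hε hA ?_
  generalize (infRotate w A).1 = X at h0
  have h1 : (Gam γ₁ γ₂ γ₃ * Xᴴ * X).trace.re =
      ∑ k, ![γ₁, γ₁, γ₁ + γ₂ + γ₃] k * ∑ j, Complex.normSq (X j k) := by
    simp only [Matrix.trace, Matrix.diag, Complex.re_sum, mul_assoc]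
    refine Finset.sum_congr rfl fun k _ => ?_
    have : Gam γ₁ γ₂ γ₃ = Matrix.diagonal fun k => ((![γ₁, γ₁, γ₁ + γ₂ + γ₃] k : ℝ) : ℂ) := by
      rw [Gam, toC, Matrix.diagonal_map Complex.ofReal_zero]
    rw [this, Matrix.diagonal_mul, Complex.re_ofReal_mul, Matrix.mul_apply, Complex.re_sum]
    congr 1
    refine Finset.sum_congr rfl fun j _ => ?_
    simp [Complex.normSq_apply]
  rw [h1] at h0
  have hγ : ∀ k, 0 < ![γ₁, γ₁, γ₁ + γ₂ + γ₃] k := by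
    intro k
    fin_cases k <;> simp <;> linarith
  have hn : ∀ k, 0 ≤ ∑ j, Complex.normSq (X j k) := fun k =>
    Finset.sum_nonneg fun j _ => Complex.normSq_nonneg _
  have h2 := (Finset.sum_eq_zero_iff_of_nonneg fun k _ => mul_nonneg (hγ k).le (hn k)).1 h0.symm
  ext j k
  have h3 := (mul_eq_zero.1 (h2 k (Finset.mem_univ k))).resolve_left (hγ k).ne'
  have h4 := (Finset.sum_eq_zero_iff_of_nonneg fun j _ => Complex.normSq_nonneg _).1 h3 j
    (Finset.mem_univ j)
  exact Complex.normSq_eq_zero.1 h4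

/-- ŵ is real and skew, so ad ŵ is skew for the invariant pairing. -/
theorem pairing_infRotate (w : Fin 3 → ℝ) (A B : OrderParam) :
    pairing A.1 (infRotate w B).1 = -pairing (infRotate w A).1 B.1 := by
  simp only [pairing, infRotate, Matrix.conjTranspose_sub, Matrix.conjTranspose_mul,
    toC_conjTranspose, hat_transpose, mul_sub, sub_mul, Matrix.trace_sub, Complex.sub_re,
    mul_neg, neg_mul, Matrix.trace_neg, Complex.neg_re]
  rw [← mul_assoc, ← mul_assoc, Matrix.trace_mul_comm (A.1ᴴ * B.1), ← mul_assoc]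
  ring

/-- Translations in `𝔰𝔬(3)*` by elements `B ⋄ A` act transitively over a point of the orbit. -/
theorem exists_diamond_eq {ε : ℝ} (hε : ε = 1 ∨ ε = -1) {A : OrderParam}
    (hA : A ∈ phaseOrbit (omega8 ε)) (m : Fin 3 → ℝ) : ∃ B, diamond B A = m := by
  have hu := inertia_det_isUnit (γ₁ := 1) (γ₂ := 0) (γ₃ := 0) hε one_pos (by simp) hA
  -- Take Γ = 1 and B = -[ŵ, A]. Then (B ⋄ A)·v = ⟨[v̂, A], [ŵ, A]⟩ = v·Jw, so w = J⁻¹m is the right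
  -- choice.
  refine ⟨infRotate (-((inertia 1 0 0 A)⁻¹ *ᵥ m)) A, ?_⟩
  have hG : Gam 1 0 0 = 1 := by
    have : (![1, 1, 1 + 0 + 0] : Fin 3 → ℝ) = fun _ => 1 := by
      ext i
      fin_cases i <;> simp
    rw [Gam, this, Matrix.diagonal_one, toC_one]
  ext a
  have h := dotProduct_inertia_mulVec 1 0 0 A (Pi.single a 1) (-((inertia 1 0 0 A)⁻¹ *ᵥ m))
  rw [hG, one_mul, Matrix.mulVec_neg, Matrix.mulVec_mulVec, Matrix.mul_nonsing_inv _ hu,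
    Matrix.one_mulVec] at h
  simp only [diamond]
  rw [pairing_infRotate, pairing, ← h]
  simp

theorem coadjointOrbit_eq {ε : ℝ} (hε : ε = 1 ∨ ε = -1) (μ : Fin 3 → ℝ) :
    coadjointOrbit (μ, omega8 ε) = Set.univ ×ˢ phaseOrbit (omega8 ε) := by
  ext ⟨m, A⟩
  simp only [Set.mem_prod, Set.mem_univ, true_and]
  constructor
  · rintro ⟨R, B, h⟩
    rw [(Prod.mk.inj h).2, phaseOrbit_omega8 hε]
    exact ⟨R, rfl⟩
  · intro hA
    have hA' := hA
    rw [phaseOrbit_omega8 hε] at hA'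
    obtain ⟨R, rfl⟩ := hA'
    obtain ⟨B, hB⟩ := exists_diamond_eq hε hA (m - R.1 *ᵥ μ)
    refine ⟨R, B, ?_⟩
    dsimp only at hB
    simp only [coadjoint, hB, add_sub_cancel]

/-- In Re Tr(Γ [v̂, A]* [ŵ, A]) conjugation by R cancels once R can be moved past Γ; only such
rotations are claimed as symmetries. -/
theorem inertia_rotate {R : SO3} (hR : Gam γ₁ γ₂ γ₃ * toC R.1 = toC R.1 * Gam γ₁ γ₂ γ₃)
    (A : OrderParam) :
    inertia γ₁ γ₂ γ₃ (rotate R A) = R.1 * inertia γ₁ γ₂ γ₃ A * R.1ᵀ := by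
  refine matrix_ext_dotProduct fun v w => ?_
  have hc : ∀ v, v = R.1 *ᵥ (R.1ᵀ *ᵥ v) := fun v => by
    rw [Matrix.mulVec_mulVec, mul_transpose_self, Matrix.one_mulVec]
  have e : v ⬝ᵥ ((R.1 * inertia γ₁ γ₂ γ₃ A * R.1ᵀ) *ᵥ w) =
      (R.1ᵀ *ᵥ v) ⬝ᵥ (inertia γ₁ γ₂ γ₃ A *ᵥ (R.1ᵀ *ᵥ w)) := by
    rw [Matrix.mulVec_transpose R.1 v, ← Matrix.dotProduct_mulVec]
    simp only [Matrix.mulVec_mulVec, mul_assoc]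
  rw [e, dotProduct_inertia_mulVec, dotProduct_inertia_mulVec]
  conv_lhs => rw [hc v, hc w]
  rw [infRotate_rotate, infRotate_rotate]
  simp only [rotate, Matrix.conjTranspose_mul, ← toC_transpose, toC_conjTranspose,
    Matrix.transpose_transpose, mul_assoc]
  simp only [toC_transpose, transpose_mul_cancel_left]
  rw [← mul_assoc, hR, mul_assoc, Matrix.trace_mul_comm]
  simp only [mul_assoc, toC_transpose_mul, mul_one]

theorem velocity_rotate {R : SO3} (hR : Gam γ₁ γ₂ γ₃ * toC R.1 = toC R.1 * Gam γ₁ γ₂ γ₃)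
    (m : Fin 3 → ℝ) (A : OrderParam) :
    velocity γ₁ γ₂ γ₃ (R.1 *ᵥ m, rotate R A) = R.1 *ᵥ velocity γ₁ γ₂ γ₃ (m, A) := by
  have h1 : (R.1)⁻¹ = R.1ᵀ := Matrix.inv_eq_right_inv (mul_transpose_self R)
  have h2 : (R.1ᵀ)⁻¹ = R.1 := Matrix.inv_eq_right_inv (transpose_mul_self R)
  simp only [velocity, inertia_rotate hR, Matrix.mul_inv_rev, h1, h2, Matrix.mulVec_smul,
    Matrix.mulVec_mulVec, mul_assoc, transpose_mul_self, mul_one]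

theorem hamiltonian_eq (p : Phase) :
    hamiltonian γ₁ γ₂ γ₃ p = 1 / 2 * (p.1 ⬝ᵥ velocity γ₁ γ₂ γ₃ p) := by
  simp only [hamiltonian, velocity, dotProduct_smul, smul_eq_mul]
  ring

theorem hamiltonian_rotate {R : SO3} (hR : Gam γ₁ γ₂ γ₃ * toC R.1 = toC R.1 * Gam γ₁ γ₂ γ₃)
    (m : Fin 3 → ℝ) (A : OrderParam) :
    hamiltonian γ₁ γ₂ γ₃ (R.1 *ᵥ m, rotate R A) = hamiltonian γ₁ γ₂ γ₃ (m, A) := by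
  rw [hamiltonian_eq, hamiltonian_eq, velocity_rotate hR, Matrix.dotProduct_mulVec,
    Matrix.vecMul_mulVec, transpose_mul_self, Matrix.vecMul_one]

theorem pairing_mul_Gam (X Y : Matrix (Fin 3) (Fin 3) ℂ) :
    pairing (X * Gam γ₁ γ₂ γ₃) Y = (Gam γ₁ γ₂ γ₃ * Xᴴ * Y).trace.re := by
  rw [pairing, Matrix.conjTranspose_mul, Gam_conjTranspose]

theorem jm_rotate {R : SO3} (hR : Gam γ₁ γ₂ γ₃ * toC R.1 = toC R.1 * Gam γ₁ γ₂ γ₃)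
    (m : Fin 3 → ℝ) (A : OrderParam) :
    jm γ₁ γ₂ γ₃ (R.1 *ᵥ m, rotate R A) = jm γ₁ γ₂ γ₃ (m, A) := by
  simp only [jm, velocity_rotate hR, infRotate_rotate, pairing_mul_Gam]
  simp only [rotate, Matrix.conjTranspose_mul, ← toC_transpose, toC_conjTranspose,
    Matrix.transpose_transpose, mul_assoc, mul_smul_comm]
  simp only [toC_transpose, transpose_mul_cancel_left]
  rw [← mul_assoc, hR, mul_assoc, Matrix.trace_smul, Matrix.trace_mul_comm, Matrix.trace_smul]
  simp only [mul_assoc, toC_transpose_mul, mul_one]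

theorem inertia_phaseShift (θ : ℝ) (A : OrderParam) :
    inertia γ₁ γ₂ γ₃ (phaseShift θ A) = inertia γ₁ γ₂ γ₃ A := by
  have h : Complex.exp (θ * Complex.I) * star (Complex.exp (θ * Complex.I)) = 1 := by
    rw [← starRingEnd_apply, Complex.mul_conj, Complex.normSq_eq_norm_sq,
      Complex.norm_exp_ofReal_mul_I]
    simp
  ext a b
  simp only [inertia, Matrix.of_apply, infRotate_phaseShift]
  simp only [phaseShift, Matrix.conjTranspose_smul, mul_smul_comm, smul_mul_assoc, smul_smul, h,
    one_smul]

theorem hamiltonian_phaseShift (θ : ℝ) (m : Fin 3 → ℝ) (A : OrderParam) :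
    hamiltonian γ₁ γ₂ γ₃ (m, phaseShift θ A) = hamiltonian γ₁ γ₂ γ₃ (m, A) := by
  simp only [hamiltonian, inertia_phaseShift]

/-- Replacing iA by [ŵ', A] with w' = -εx turns j_m into 2w'·Jw, and 2Jw = m. -/
theorem jm_eq {ε : ℝ} (hε : ε = 1 ∨ ε = -1) (h₁ : 0 < γ₁) (h₂₃ : 0 ≤ γ₂ + γ₃)
    {A : OrderParam} (hA : A ∈ phaseOrbit (omega8 ε)) (m : Fin 3 → ℝ) :
    jm γ₁ γ₂ γ₃ (m, A) = -ε * (m ⬝ᵥ axis ε A) := by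
  have hu := inertia_det_isUnit hε h₁ h₂₃ hA
  rw [jm, pairing_mul_Gam]
  dsimp only
  rw [← infRotate_axis hε hA, ← dotProduct_inertia_mulVec,
    dotProduct_inertia_mulVec_comm, velocity, Matrix.mulVec_smul, Matrix.mulVec_mulVec,
    Matrix.mul_nonsing_inv _ hu, Matrix.one_mulVec, smul_dotProduct, dotProduct_smul,
    dotProduct_comm]
  simp only [smul_eq_mul]
  ring

end Inertia

/-! ### Rational charts and curves in SO(3) -/

section Cayley

/-- The Cayley parametrization of `SO(3)` by `ℝ³`. -/
noncomputable def cayleyMatrix (w : Fin 3 → ℝ) : Matrix (Fin 3) (Fin 3) ℝ :=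
  (1 + w 0 ^ 2 + w 1 ^ 2 + w 2 ^ 2)⁻¹ •
    !![1 + w 0 ^ 2 - w 1 ^ 2 - w 2 ^ 2, 2 * (w 0 * w 1 - w 2), 2 * (w 0 * w 2 + w 1);
      2 * (w 0 * w 1 + w 2), 1 - w 0 ^ 2 + w 1 ^ 2 - w 2 ^ 2, 2 * (w 1 * w 2 - w 0);
      2 * (w 0 * w 2 - w 1), 2 * (w 1 * w 2 + w 0), 1 - w 0 ^ 2 - w 1 ^ 2 + w 2 ^ 2]

theorem one_add_sq_ne_zero (w : Fin 3 → ℝ) : 1 + w 0 ^ 2 + w 1 ^ 2 + w 2 ^ 2 ≠ 0 := by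
  positivity

noncomputable def cayley (w : Fin 3 → ℝ) : SO3 :=
  ⟨cayleyMatrix w, by
    have h := one_add_sq_ne_zero w
    rw [Matrix.mem_specialOrthogonalGroup_iff, Matrix.mem_orthogonalGroup_iff]
    refine ⟨?_, ?_⟩
    · rw [cayleyMatrix]
      ext i j
      fin_cases i <;> fin_cases j <;>
        simp [Matrix.mul_apply, Fin.sum_univ_three] <;> field_simp <;> ring
    · rw [cayleyMatrix, Matrix.det_smul, Matrix.det_fin_three]
      simp
      field_simp
      ring⟩

/-- The inverse of the Cayley parametrization. -/
noncomputable def cayleyInv (Q : Matrix (Fin 3) (Fin 3) ℝ) : Fin 3 → ℝ :=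
  (1 + Q.trace)⁻¹ • ![Q 2 1 - Q 1 2, Q 0 2 - Q 2 0, Q 1 0 - Q 0 1]

theorem one_add_trace_cayley (w : Fin 3 → ℝ) :
    1 + (cayleyMatrix w).trace = 4 / (1 + w 0 ^ 2 + w 1 ^ 2 + w 2 ^ 2) := by
  have h := one_add_sq_ne_zero w
  simp [Matrix.trace_fin_three, cayleyMatrix]
  field_simp
  ring

theorem cayleyInv_cayley (w : Fin 3 → ℝ) : cayleyInv (cayleyMatrix w) = w := by
  have h := one_add_sq_ne_zero w
  ext i
  rw [cayleyInv, one_add_trace_cayley]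
  fin_cases i <;> simp [cayleyMatrix] <;> field_simp <;> ring

/-- Trace -1 characterizes the half-turns, the rotations missed by the Cayley chart. -/
theorem cayley_cayleyInv (Q : SO3) (h : 1 + Q.1.trace ≠ 0) : cayley (cayleyInv Q.1) = Q := by
  obtain ⟨⟨h00, h01, h02⟩, ⟨h10, h11, h12⟩, h20, h21, h22⟩ := cofactors Q
  have row := fun i j => congrFun (congrFun (mul_transpose_self Q) i) j
  have col := fun i j => congrFun (congrFun (transpose_mul_self Q) i) j
  simp only [Matrix.mul_apply, Fin.sum_univ_three, Matrix.transpose_apply] at row col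
  have r00 := row 0 0
  have r11 := row 1 1
  have r22 := row 2 2
  have r01 := row 0 1
  have r02 := row 0 2
  have r12 := row 1 2
  have c00 := col 0 0
  have c11 := col 1 1
  have c22 := col 2 2
  have c01 := col 0 1
  have c02 := col 0 2
  have c12 := col 1 2
  simp at r00 r11 r22 r01 r02 r12 c00 c11 c22 c01 c02 c12
  set t := 1 + Q.1.trace with ht
  have ht' : t = 1 + (Q.1 0 0 + Q.1 1 1 + Q.1 2 2) := by rw [ht, Matrix.trace_fin_three]
  have w0 : cayleyInv Q.1 0 = (Q.1 2 1 - Q.1 1 2) / t := by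
    simp [cayleyInv, ← ht]; ring
  have w1 : cayleyInv Q.1 1 = (Q.1 0 2 - Q.1 2 0) / t := by
    simp [cayleyInv, ← ht]; ring
  have w2 : cayleyInv Q.1 2 = (Q.1 1 0 - Q.1 0 1) / t := by
    simp [cayleyInv, ← ht]; ring
  clear_value t
  -- For a unit quaternion (q₀, q₁, q₂, q₃) of Q, t = 4q₀² and the skew differences are 4q₀qᵢ. The
  -- six relations say (4q₀qᵢ)(4q₀qⱼ) = t·4qᵢqⱼ.
  have s0 : (Q.1 2 1 - Q.1 1 2) ^ 2 = t * (2 * Q.1 0 0 + 2 - t) := by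
    rw [ht']
    linear_combination r11 + r22 - c00 - 2 * h00
  have s1 : (Q.1 0 2 - Q.1 2 0) ^ 2 = t * (2 * Q.1 1 1 + 2 - t) := by
    rw [ht']
    linear_combination r00 + r22 - c11 - 2 * h11
  have s2 : (Q.1 1 0 - Q.1 0 1) ^ 2 = t * (2 * Q.1 2 2 + 2 - t) := by
    rw [ht']
    linear_combination r00 + r11 - c22 - 2 * h22
  have p01 : (Q.1 2 1 - Q.1 1 2) * (Q.1 0 2 - Q.1 2 0) = t * (Q.1 0 1 + Q.1 1 0) := by
    rw [ht']
    linear_combination -h01 - h10 - r01 - c01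
  have p02 : (Q.1 2 1 - Q.1 1 2) * (Q.1 1 0 - Q.1 0 1) = t * (Q.1 0 2 + Q.1 2 0) := by
    rw [ht']
    linear_combination -h02 - h20 - r02 - c02
  have p12 : (Q.1 0 2 - Q.1 2 0) * (Q.1 1 0 - Q.1 0 1) = t * (Q.1 1 2 + Q.1 2 1) := by
    rw [ht']
    linear_combination -h12 - h21 - r12 - c12
  have hs : 1 + cayleyInv Q.1 0 ^ 2 + cayleyInv Q.1 1 ^ 2 + cayleyInv Q.1 2 ^ 2 = 4 / t := by
    rw [w0, w1, w2]
    field_simp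
    linear_combination s0 + s1 + s2 - 2 * t * ht'
  refine Subtype.ext ?_
  ext i j
  simp only [cayley, cayleyMatrix, hs]
  have q01 : cayleyInv Q.1 0 * cayleyInv Q.1 1 = (Q.1 0 1 + Q.1 1 0) / t := by
    rw [w0, w1]; field_simp; linear_combination p01
  have q02 : cayleyInv Q.1 0 * cayleyInv Q.1 2 = (Q.1 0 2 + Q.1 2 0) / t := by
    rw [w0, w2]; field_simp; linear_combination p02
  have q12 : cayleyInv Q.1 1 * cayleyInv Q.1 2 = (Q.1 1 2 + Q.1 2 1) / t := by
    rw [w1, w2]; field_simp; linear_combination p12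
  have q0 : cayleyInv Q.1 0 ^ 2 = (2 * Q.1 0 0 + 2 - t) / t := by
    rw [w0, div_pow, s0]; field_simp
  have q1 : cayleyInv Q.1 1 ^ 2 = (2 * Q.1 1 1 + 2 - t) / t := by
    rw [w1, div_pow, s1]; field_simp
  have q2 : cayleyInv Q.1 2 ^ 2 = (2 * Q.1 2 2 + 2 - t) / t := by
    rw [w2, div_pow, s2]; field_simp
  fin_cases i <;> fin_cases j <;> simp [q0, q1, q2, q01, q02, q12] <;>
    (try simp only [w0, w1, w2]) <;> field_simp <;> linarith [ht']

/-- Covers the entries of `rotCurve` and, with d = 0, the restriction of h to a line in m. -/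
theorem hasDerivAt_quotient (a b c d : ℝ) :
    HasDerivAt (fun t : ℝ => (1 + t ^ 2 * d)⁻¹ * (a + t * b + t ^ 2 * c)) b 0 := by
  have h2 : HasDerivAt (fun t : ℝ => t ^ 2) 0 0 := by simpa using hasDerivAt_pow 2 (0 : ℝ)
  have hd := ((h2.mul_const d).const_add 1).inv (by norm_num)
  have hn := (((hasDerivAt_id (0 : ℝ)).mul_const b).const_add a).add (h2.mul_const c)
  have h : HasDerivAt (fun t : ℝ => (1 + t ^ 2 * d)⁻¹ * (a + t * b + t ^ 2 * c)) _ 0 := hd.mul hn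
  convert h using 1
  simp

/-- A curve in `SO(3)` through `1` with velocity `ŵ`. -/
noncomputable def rotCurve (w : Fin 3 → ℝ) (t : ℝ) : SO3 := cayley ((t / 2) • w)

theorem rotCurve_zero (w : Fin 3 → ℝ) : rotCurve w 0 = 1 := by
  refine Subtype.ext ?_
  ext i j
  fin_cases i <;> fin_cases j <;> simp [rotCurve, cayley, cayleyMatrix]

/-- The Cayley matrix is 1 + 2ŵ to first order, hence the parameter t/2; each entry is a quadratic
in t over 1 + t²|w|²/4. -/
theorem hasDerivAt_rotCurve (w : Fin 3 → ℝ) :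
    HasDerivAt (fun t => (rotCurve w t).1) (hat w) 0 := by
  have hq : ∀ (N : ℝ → ℝ) (a b c : ℝ), (∀ t, N t = a + t * b + t ^ 2 * c) →
      HasDerivAt (fun t : ℝ => (1 + (t / 2 * w 0) ^ 2 + (t / 2 * w 1) ^ 2 +
        (t / 2 * w 2) ^ 2)⁻¹ * N t) b 0 := by
    intro N a b c hN
    refine (hasDerivAt_quotient a b c ((w 0 ^ 2 + w 1 ^ 2 + w 2 ^ 2) / 4)).congr_of_eventuallyEq
      (Filter.Eventually.of_forall fun t => ?_)
    simp only [hN]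
    congr 2
    ring
  refine hasDerivAt_matrix.2 fun i j => ?_
  simp only [rotCurve, cayley, cayleyMatrix, Matrix.smul_apply, smul_eq_mul, Pi.smul_apply]
  fin_cases i <;> fin_cases j <;> simp [hat, -mul_eq_mul_left_iff]
  · exact hq _ 1 _ ((w 0 ^ 2 - w 1 ^ 2 - w 2 ^ 2) / 4) fun t => by ring
  · exact hq _ 0 _ (w 0 * w 1 / 2) fun t => by ring
  · exact hq _ 0 _ (w 0 * w 2 / 2) fun t => by ring
  · exact hq _ 0 _ (w 0 * w 1 / 2) fun t => by ring
  · exact hq _ 1 _ ((-w 0 ^ 2 + w 1 ^ 2 - w 2 ^ 2) / 4) fun t => by ring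
  · exact hq _ 0 _ (w 1 * w 2 / 2) fun t => by ring
  · exact hq _ 0 _ (w 0 * w 2 / 2) fun t => by ring
  · exact hq _ 0 _ (w 1 * w 2 / 2) fun t => by ring
  · exact hq _ 1 _ ((-w 0 ^ 2 - w 1 ^ 2 + w 2 ^ 2) / 4) fun t => by ring

theorem hasDerivAt_rotCurve_mulVec (w m : Fin 3 → ℝ) :
    HasDerivAt (fun t => (rotCurve w t).1 *ᵥ m) (w ⨯₃ m) 0 := by
  rw [← hat_mulVec]
  refine hasDerivAt_pi.2 fun i => ?_
  simp only [Matrix.mulVec, dotProduct]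
  exact HasDerivAt.fun_sum fun j _ =>
    (hasDerivAt_matrix.1 (hasDerivAt_rotCurve w) i j).mul_const (m j)

theorem hasDerivAt_rotate_rotCurve (w : Fin 3 → ℝ) (A : OrderParam) :
    HasDerivAt (fun t => rotate (rotCurve w t) A) (infRotate w A) 0 := by
  refine hasDerivAt_orderParam ?_
  have hR := (hasDerivAt_rotCurve w).toC
  have hA : HasDerivAt (fun _ : ℝ => A.1) 0 0 := hasDerivAt_const _ _
  have h := (hR.matrix_mul hA).matrix_mul hR.matrix_transpose
  convert h using 1
  · rfl
  · simp [rotCurve_zero, toC_one, infRotate, hat_transpose, sub_eq_add_neg]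

theorem hasDerivAt_phaseShift {ε : ℝ} (hε : ε = 1 ∨ ε = -1) {A : OrderParam}
    (hA : A ∈ phaseOrbit (omega8 ε)) :
    HasDerivAt (fun θ => phaseShift θ A) (infRotate (-ε • axis ε A) A) 0 := by
  refine hasDerivAt_orderParam ?_
  rw [infRotate_axis hε hA]
  refine hasDerivAt_matrix.2 fun i j => ?_
  have h1 : HasDerivAt (fun θ : ℝ => Complex.exp (θ * Complex.I)) Complex.I 0 := by
    simpa using ((hasDerivAt_id (0 : ℝ)).ofReal_comp.mul_const Complex.I).cexp
  exact h1.mul_const (A.1 i j)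

theorem phaseShift_zero (A : OrderParam) : phaseShift 0 A = A := by
  ext1
  simp [phaseShift]

/-- Rotations about e₃ mix only the first two coordinates, on which Γ is scalar. -/
theorem Gam_comm_rotCurve (γ₁ γ₂ γ₃ t : ℝ) :
    Gam γ₁ γ₂ γ₃ * toC (rotCurve (Pi.single 2 1) t).1 =
      toC (rotCurve (Pi.single 2 1) t).1 * Gam γ₁ γ₂ γ₃ := by
  rw [Gam, ← toC_mul, ← toC_mul]
  congr 1
  ext i j
  rw [Matrix.diagonal_mul, Matrix.mul_diagonal]
  fin_cases i <;> fin_cases j <;> simp [rotCurve, cayley, cayleyMatrix, mul_comm]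

end Cayley

/-! ### The orbit as a submanifold -/

section Orbit

variable {E : Type*} [NormedAddCommGroup E] [NormedSpace ℝ E]

theorem contDiff_axis (ε : ℝ) : ContDiff ℝ ∞ (axis ε) := by
  rw [← contDiffOn_univ]
  have h := (contDiff_coe_orderParam.contDiffOn (s := Set.univ)).matrix_mul
    (contDiff_coe_orderParam.contDiffOn (s := Set.univ)).matrix_conjTranspose
  have him := fun i j => Complex.imCLM.contDiff.comp_contDiffOn (h.entry i j)
  refine contDiffOn_pi.2 fun i => ?_
  fin_cases i
  · exact contDiffOn_const.mul (him 2 1)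
  · exact contDiffOn_const.mul (him 0 2)
  · exact contDiffOn_const.mul (him 1 0)

theorem contDiff_frame (ε : ℝ) : ContDiff ℝ ∞ (frame ε) := by
  have hx := contDiff_pi.1 (contDiff_axis ε)
  have hu : ∀ i, ContDiff ℝ ∞
      (fun A : OrderParam => (A.1 *ᵥ fun k => (axis ε A k : ℂ)) i) := by
    intro i
    have h := (contDiff_coe_orderParam.contDiffOn (s := Set.univ)).matrix_mulVec
      (contDiffOn_pi.2 fun k =>
        (Complex.ofRealCLM.contDiff.comp (hx k)).contDiffOn (s := Set.univ))
    exact contDiffOn_univ.1 (contDiffOn_pi.1 h i)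
  rw [← contDiffOn_univ]
  refine contDiffOn_matrix fun i j => contDiffOn_univ.2 ?_
  fin_cases j
  · exact hx i
  · exact Complex.reCLM.contDiff.comp (hu i)
  · exact contDiff_const.mul (Complex.imCLM.contDiff.comp (hu i))

theorem SmoothOnSubset.of_contDiffOn {F : Type*} [NormedAddCommGroup F] [NormedSpace ℝ F]
    {f : E → F} {X U : Set E} (hU : IsOpen U) (hX : X ⊆ U) (hf : ContDiffOn ℝ ∞ f U) :
    SmoothOnSubset f X :=
  fun _ hx => ⟨U, hU, hX hx, f, hf, fun _ _ => rfl⟩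

/-- The map `R ↦ R A₀ R⁻¹` on `SO(3)` has a smooth extension to all matrices. -/
theorem exists_rotate_extension (A : OrderParam) :
    ∃ φ : Matrix (Fin 3) (Fin 3) ℝ → OrderParam, (∀ R : SO3, φ R.1 = rotate R A) ∧
      ∀ {E : Type} [NormedAddCommGroup E] [NormedSpace ℝ E]
        (f : E → Matrix (Fin 3) (Fin 3) ℝ) (s : Set E), ContDiffOn ℝ ∞ f s →
          ContDiffOn ℝ ∞ (fun x => φ (f x)) s := by
  obtain ⟨P, hP, hPA⟩ := exists_projection
  refine ⟨fun M => P (toC M * A.1 * (toC M)ᵀ), fun R => hPA (rotate R A), ?_⟩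
  intro E _ _ f s hf
  exact hP.comp_contDiffOn
    ((hf.toC.matrix_mul contDiffOn_const).matrix_mul hf.toC.matrix_transpose)

theorem isDiffeoOn_rotate {ε : ℝ} (hε : ε = 1 ∨ ε = -1) :
    ∃ φ : Matrix (Fin 3) (Fin 3) ℝ → OrderParam,
      (∀ R : SO3, φ R.1 = rotate R (omega8 ε)) ∧
      IsDiffeoOn φ (Matrix.specialOrthogonalGroup (Fin 3) ℝ : Set (Matrix (Fin 3) (Fin 3) ℝ))
        (phaseOrbit (omega8 ε)) := by
  obtain ⟨φ, hφ, hs⟩ := exists_rotate_extension (omega8 ε)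
  have hl : Set.LeftInvOn (frame ε) φ
      (Matrix.specialOrthogonalGroup (Fin 3) ℝ : Set (Matrix (Fin 3) (Fin 3) ℝ)) := by
    intro M hM
    rw [hφ ⟨M, hM⟩, frame_rotate_omega8 hε]
  refine ⟨φ, hφ, ⟨?_, hl.injOn, ?_⟩, ?_, frame ε, hl, ?_⟩
  · intro M hM
    rw [hφ ⟨M, hM⟩, phaseOrbit_omega8 hε]
    exact ⟨_, rfl⟩
  · rw [phaseOrbit_omega8 hε]
    rintro _ ⟨R, rfl⟩
    exact ⟨R.1, R.2, hφ R⟩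
  · exact .of_contDiffOn isOpen_univ (Set.subset_univ _) (hs id _ contDiffOn_id)
  · exact .of_contDiffOn isOpen_univ (Set.subset_univ _) (contDiff_frame ε).contDiffOn

theorem contDiffOn_cayleyMatrix {f : E → Fin 3 → ℝ} {s : Set E} (hf : ContDiffOn ℝ ∞ f s) :
    ContDiffOn ℝ ∞ (fun x => cayleyMatrix (f x)) s := by
  have h := contDiffOn_pi.1 hf
  have h0 := h 0
  have h1 := h 1
  have h2 := h 2
  have hd : ContDiffOn ℝ ∞ (fun x => (1 + f x 0 ^ 2 + f x 1 ^ 2 + f x 2 ^ 2)⁻¹) s :=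
    ContDiffOn.inv (by fun_prop) fun x _ => one_add_sq_ne_zero (f x)
  refine contDiffOn_matrix fun i j => ?_
  simp only [cayleyMatrix, Matrix.smul_apply, smul_eq_mul]
  refine hd.mul ?_
  fin_cases i <;> fin_cases j <;> simp <;> fun_prop

theorem contDiffOn_cayleyInv {f : E → Matrix (Fin 3) (Fin 3) ℝ} {s : Set E}
    (hf : ContDiffOn ℝ ∞ f s) (h0 : ∀ x ∈ s, 1 + (f x).trace ≠ 0) :
    ContDiffOn ℝ ∞ (fun x => cayleyInv (f x)) s := by
  have e := hf.entry
  have hd : ContDiffOn ℝ ∞ (fun x => (1 + (f x).trace)⁻¹) s := by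
    refine ContDiffOn.inv ?_ h0
    simp only [Matrix.trace_fin_three]
    fun_prop
  refine contDiffOn_pi.2 fun i => ?_
  simp only [cayleyInv, Pi.smul_apply, smul_eq_mul]
  refine hd.mul ?_
  fin_cases i <;> simp <;> fun_prop

theorem contDiff_mul_frame (ε : ℝ) (M : Matrix (Fin 3) (Fin 3) ℝ) :
    ContDiff ℝ ∞ fun p : Phase => Mᵀ * frame ε p.2 := by
  rw [← contDiffOn_univ]
  exact contDiffOn_const.matrix_mul ((contDiff_frame ε).comp contDiff_snd).contDiffOn

theorem continuous_trace_frame (ε : ℝ) (M : Matrix (Fin 3) (Fin 3) ℝ) :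
    Continuous fun p : Phase => 1 + (Mᵀ * frame ε p.2).trace := by
  have e : ∀ i j, Continuous fun p : Phase => (Mᵀ * frame ε p.2) i j := fun i j =>
    (contDiffOn_univ.1 ((contDiff_mul_frame ε M).contDiffOn.entry i j)).continuous
  simp only [Matrix.trace_fin_three]
  exact continuous_const.add (((e 0 0).add (e 1 1)).add (e 2 2))

/-- The chart around R is the Cayley chart translated by R, times ℝ³. Its image is cut out by 1 +
tr(RᵀS) ≠ 0, which `frame` extends to an open condition on all of phase space; `frame` followed by
`cayleyInv` gives the smooth inverse. -/
theorem isSmoothSubmanifold_prod {ε : ℝ} (hε : ε = 1 ∨ ε = -1) :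
    IsSmoothSubmanifold 6 ((Set.univ : Set (Fin 3 → ℝ)) ×ˢ phaseOrbit (omega8 ε)) := by
  obtain ⟨Φ, hΦ, hs⟩ := exists_rotate_extension (omega8 ε)
  rintro ⟨m, A⟩ ⟨-, hA⟩
  rw [phaseOrbit_omega8 hε] at hA ⊢
  obtain ⟨R, rfl⟩ := hA
  let φ : (Fin 6 → ℝ) → Phase := fun v =>
    (![v 0, v 1, v 2], Φ (R.1 * cayleyMatrix ![v 3, v 4, v 5]))
  let κ : Phase → Fin 3 → ℝ := fun p => cayleyInv (R.1ᵀ * frame ε p.2)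
  let g : Phase → Fin 6 → ℝ := fun p => ![p.1 0, p.1 1, p.1 2, κ p 0, κ p 1, κ p 2]
  let U : Set Phase := {p | 1 + (R.1ᵀ * frame ε p.2).trace ≠ 0}
  have hφ : ∀ v, φ v = (![v 0, v 1, v 2], rotate (R * cayley ![v 3, v 4, v 5]) (omega8 ε)) :=
    fun v => by
      rw [← hΦ]
      rfl
  have hfr : ∀ v, R.1ᵀ * frame ε (φ v).2 = cayleyMatrix ![v 3, v 4, v 5] := fun v => by
    rw [hφ]
    dsimp only
    rw [frame_rotate_omega8 hε, Submonoid.coe_mul, ← mul_assoc, transpose_mul_self, one_mul]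
    rfl
  have hφU : ∀ v, φ v ∈ U := fun v => by
    simp only [U, Set.mem_ofPred_eq, hfr, one_add_trace_cayley]
    exact div_ne_zero four_ne_zero (one_add_sq_ne_zero _)
  have hfrs := contDiff_mul_frame ε R.1
  have hU : IsOpen U := by
    exact isOpen_ne_fun (continuous_trace_frame ε R.1) continuous_const
  have hl : Set.LeftInvOn g φ Set.univ := by
    intro v _
    ext i
    simp only [g, κ, hfr, cayleyInv_cayley]
    fin_cases i <;> simp [φ]
  have himg : φ '' Set.univ = U ∩ (Set.univ ×ˢ Set.range fun R : SO3 => rotate R (omega8 ε)) := by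
    ext p
    constructor
    · rintro ⟨v, -, rfl⟩
      refine ⟨hφU v, Set.mem_univ _, ?_⟩
      rw [hφ]
      exact ⟨_, rfl⟩
    · obtain ⟨m, A⟩ := p
      rintro ⟨hp, -, ⟨S, rfl⟩⟩
      have hT : R.1ᵀ * S.1 ∈ Matrix.specialOrthogonalGroup (Fin 3) ℝ := (R⁻¹ * S).2
      have hp' : 1 + (R.1ᵀ * S.1).trace ≠ 0 := by
        simpa only [U, Set.mem_ofPred_eq, frame_rotate_omega8 hε] using hp
      have hc := cayley_cayleyInv ⟨_, hT⟩ hp'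
      refine ⟨g (m, rotate S (omega8 ε)), Set.mem_univ _, ?_⟩
      have hκ : (![g (m, rotate S (omega8 ε)) 3, g (m, rotate S (omega8 ε)) 4,
          g (m, rotate S (omega8 ε)) 5] : Fin 3 → ℝ) = cayleyInv (R.1ᵀ * S.1) := by
        ext i
        fin_cases i <;> simp [g, κ, frame_rotate_omega8 hε]
      rw [hφ, hκ, hc]
      refine Prod.ext ?_ ?_
      · ext i
        fin_cases i <;> simp [g]
      · dsimp only
        congr 1
        refine Subtype.ext ?_
        rw [Submonoid.coe_mul, ← mul_assoc, mul_transpose_self, one_mul]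
  have hφs : ContDiff ℝ ∞ φ := by
    refine ContDiff.prodMk ?_ (contDiffOn_univ.1 (hs _ _ ?_))
    · refine contDiff_pi.2 fun i => ?_
      fin_cases i <;> simp <;> fun_prop
    · refine contDiffOn_const.matrix_mul (contDiffOn_cayleyMatrix ?_)
      refine contDiffOn_univ.2 (contDiff_pi.2 fun i => ?_)
      fin_cases i <;> simp <;> fun_prop
  have hgs : ContDiffOn ℝ ∞ g U := by
    have hκ := contDiffOn_pi.1 (contDiffOn_cayleyInv (hfrs.contDiffOn (s := U)) fun _ h => h)
    have hm : ∀ i : Fin 3, ContDiffOn ℝ ∞ (fun p : Phase => p.1 i) U := fun i =>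
      ((contDiff_apply ℝ ℝ i).comp contDiff_fst).contDiffOn
    refine contDiffOn_pi.2 fun i => ?_
    fin_cases i
    exacts [hm 0, hm 1, hm 2, hκ 0, hκ 1, hκ 2]
  refine ⟨Set.univ, φ, ⟨isOpen_univ, ⟨U, hU, himg⟩, ?_⟩, ?_⟩
  · refine ⟨hl.injOn.bijOn_image, ?_, g, hl, ?_⟩
    · exact .of_contDiffOn isOpen_univ (Set.subset_univ _) hφs.contDiffOn
    · exact .of_contDiffOn hU (himg ▸ Set.inter_subset_left) hgs
  · refine ⟨![m 0, m 1, m 2, 0, 0, 0], Set.mem_univ _, ?_⟩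
    rw [hφ]
    refine Prod.ext ?_ ?_
    · ext i
      fin_cases i <;> simp
    · have : cayley (![0, 0, 0] : Fin 3 → ℝ) = 1 := by
        rw [← rotCurve_zero 0, rotCurve]
        congr 1
        ext i
        fin_cases i <;> simp
      simp [this]

end Orbit

/-! ### Smoothness where the inertia matrix is invertible -/

section Smoothness

variable {E : Type*} [NormedAddCommGroup E] [NormedSpace ℝ E] {γ₁ γ₂ γ₃ : ℝ}

theorem ContDiffOn.trace_re {f : E → Matrix (Fin 3) (Fin 3) ℂ} {s : Set E}
    (hf : ContDiffOn ℝ ∞ f s) : ContDiffOn ℝ ∞ (fun x => (f x).trace.re) s := by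
  have e : ∀ i, ContDiffOn ℝ ∞ (fun x => (f x i i).re) s := fun i =>
    Complex.reCLM.contDiff.comp_contDiffOn (hf.entry i i)
  simp only [Matrix.trace_fin_three, Complex.add_re]
  exact ((e 0).add (e 1)).add (e 2)

theorem contDiffOn_infRotate {w : E → Fin 3 → ℝ} {A : E → OrderParam} {s : Set E}
    (hw : ContDiffOn ℝ ∞ w s) (hA : ContDiffOn ℝ ∞ A s) :
    ContDiffOn ℝ ∞ (fun x => (infRotate (w x) (A x)).1) s := by
  have h := contDiffOn_pi.1 hw
  have hhat : ContDiffOn ℝ ∞ (fun x => hat (w x)) s := by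
    refine contDiffOn_matrix fun i j => ?_
    have h0 := h 0
    have h1 := h 1
    have h2 := h 2
    fin_cases i <;> fin_cases j <;> simp [hat] <;> fun_prop
  have hA' := contDiff_coe_orderParam.comp_contDiffOn hA
  refine contDiffOn_matrix fun i j => ?_
  exact ((hhat.toC.matrix_mul hA').entry i j).sub ((hA'.matrix_mul hhat.toC).entry i j)

theorem contDiff_inertia : ContDiff ℝ ∞ (inertia γ₁ γ₂ γ₃) := by
  rw [← contDiffOn_univ]
  have h := fun a : Fin 3 => contDiffOn_infRotate (s := Set.univ)
    (contDiffOn_const (c := (Pi.single a 1 : Fin 3 → ℝ))) contDiffOn_id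
  exact contDiffOn_matrix fun a b =>
    ContDiffOn.trace_re ((contDiffOn_const.matrix_mul (h a).matrix_conjTranspose).matrix_mul (h b))

/-- The set of points at which the inertia matrix is invertible. -/
def regularSet (γ₁ γ₂ γ₃ : ℝ) : Set Phase := {p | (inertia γ₁ γ₂ γ₃ p.2).det ≠ 0}

theorem isOpen_regularSet : IsOpen (regularSet γ₁ γ₂ γ₃) := by
  have e : ∀ i j, Continuous fun p : Phase => inertia γ₁ γ₂ γ₃ p.2 i j := fun i j =>
    (contDiffOn_univ.1 (contDiff_inertia.contDiffOn.entry i j)).continuous.comp continuous_snd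
  have hc : Continuous fun p : Phase => (inertia γ₁ γ₂ γ₃ p.2).det := by
    simp only [Matrix.det_fin_three]
    fun_prop
  exact isOpen_ne_fun hc continuous_const

theorem contDiffOn_velocity :
    ContDiffOn ℝ ∞ (velocity γ₁ γ₂ γ₃) (regularSet γ₁ γ₂ γ₃) := by
  have hJ : ContDiffOn ℝ ∞ (fun p : Phase => (inertia γ₁ γ₂ γ₃ p.2)⁻¹) (regularSet γ₁ γ₂ γ₃) :=
    ContDiffOn.matrix_inv (contDiff_inertia.comp contDiff_snd).contDiffOn fun _ h => h
  exact (hJ.matrix_mulVec contDiff_fst.contDiffOn).const_smul (1 / 2 : ℝ)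

theorem contDiffOn_hamiltonian :
    ContDiffOn ℝ ∞ (hamiltonian γ₁ γ₂ γ₃) (regularSet γ₁ γ₂ γ₃) := by
  have h : hamiltonian γ₁ γ₂ γ₃ = fun p => 1 / 2 * (p.1 ⬝ᵥ velocity γ₁ γ₂ γ₃ p) :=
    funext hamiltonian_eq
  rw [h]
  exact contDiffOn_const.mul (contDiff_fst.contDiffOn.dotProduct contDiffOn_velocity)

theorem contDiffOn_jm : ContDiffOn ℝ ∞ (jm γ₁ γ₂ γ₃) (regularSet γ₁ γ₂ γ₃) := by
  have hX := (contDiffOn_infRotate (contDiffOn_velocity (γ₁ := γ₁) (γ₂ := γ₂) (γ₃ := γ₃))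
    contDiff_snd.contDiffOn).matrix_mul (contDiffOn_const (c := Gam γ₁ γ₂ γ₃))
  have hA : ContDiffOn ℝ ∞ (fun p : Phase => Complex.I • p.2.1) (regularSet γ₁ γ₂ γ₃) :=
    contDiffOn_matrix fun i j => contDiffOn_const.mul
      ((contDiff_coe_orderParam.comp contDiff_snd).contDiffOn.entry i j)
  exact contDiffOn_const.mul (hX.matrix_conjTranspose.matrix_mul hA).trace_re

theorem contDiff_J3 : ContDiff ℝ ∞ J3 := (contDiff_apply ℝ ℝ (2 : Fin 3)).comp contDiff_fst

end Smoothness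

/-! ### Computing Lie-Poisson brackets along curves -/

section Brackets

theorem hasDerivAt_momentum_line (m u : Fin 3 → ℝ) (A : OrderParam) :
    HasDerivAt (fun t : ℝ => ((m + t • u, A) : Phase)) (u, 0) 0 := by
  refine HasDerivAt.prodMk ?_ (hasDerivAt_const _ _)
  simpa using ((hasDerivAt_id (0 : ℝ)).smul_const u).const_add m

theorem hasDerivAt_rotation_curve (m w : Fin 3 → ℝ) (A : OrderParam) :
    HasDerivAt (fun t : ℝ => ((m, rotate (rotCurve w t) A) : Phase)) (0, infRotate w A) 0 :=
  (hasDerivAt_const _ _).prodMk (hasDerivAt_rotate_rotCurve w A)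

theorem fderiv_momentum (f : Phase → ℝ) (p : Phase) (u : Fin 3 → ℝ) :
    fderiv ℝ f p (u, 0) = gradM f p ⬝ᵥ u := by
  have h : ((u, 0) : Phase) = ∑ a, u a • (Pi.single a 1, 0) := by
    refine Prod.ext ?_ ?_
    · simp only [Prod.fst_sum, Prod.smul_fst]
      exact pi_eq_sum_univ' u
    · simp [Prod.snd_sum]
  rw [h, map_sum]
  simp only [map_smul, smul_eq_mul, dotProduct, gradM, mul_comm]

theorem gradM_eq {f : Phase → ℝ} {m g : Fin 3 → ℝ} {A : OrderParam}
    (hf : DifferentiableAt ℝ f (m, A))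
    (h : ∀ u, HasDerivAt (fun t : ℝ => f (m + t • u, A)) (g ⬝ᵥ u) 0) : gradM f (m, A) = g := by
  ext a
  exact (fderiv_eq_of_hasDerivAt_comp hf (hasDerivAt_momentum_line m (Pi.single a 1) A)
    (by simp) (h _)).trans (by simp)

theorem bracket_self (f : Phase → ℝ) (p : Phase) : bracket f f p = 0 := by
  simp [bracket, cross_self]

theorem bracket_swap (f g : Phase → ℝ) (p : Phase) : bracket f g p = -bracket g f p := by
  simp only [bracket]
  rw [← cross_anticomm, dotProduct_neg]
  ring

theorem fderiv_J3 (p q : Phase) : fderiv ℝ J3 p q = q.1 2 := by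
  have h : J3 = ((ContinuousLinearMap.proj (2 : Fin 3)).comp
      (ContinuousLinearMap.fst ℝ (Fin 3 → ℝ) OrderParam) : Phase →L[ℝ] ℝ) := rfl
  rw [h, ContinuousLinearMap.fderiv]
  rfl

theorem gradM_J3 (p : Phase) : gradM J3 p = Pi.single 2 1 := by
  ext a
  rw [gradM, fderiv_J3]
  fin_cases a <;> simp

/-- A function invariant under rotations about the third axis Poisson commutes with `J₃`. -/
theorem bracket_J3_eq_zero {f : Phase → ℝ} {m : Fin 3 → ℝ} {A : OrderParam}
    (hf : DifferentiableAt ℝ f (m, A))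
    (h : ∀ t, f ((rotCurve (Pi.single 2 1) t).1 *ᵥ m, rotate (rotCurve (Pi.single 2 1) t) A) =
      f (m, A)) : bracket f J3 (m, A) = 0 := by
  -- Infinitesimal invariance along (e₃ × m, [ê₃, A]). This is the bracket itself: m·(∂f × e₃) =
  -- ∂f·(e₃ × m), and `J3` does not depend on A.
  have hd : fderiv ℝ f (m, A) ((Pi.single 2 1 : Fin 3 → ℝ) ⨯₃ m, infRotate (Pi.single 2 1) A) =
      0 := fderiv_eq_of_hasDerivAt_comp hf
    ((hasDerivAt_rotCurve_mulVec (Pi.single 2 1) m).prodMk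
      (hasDerivAt_rotate_rotCurve (Pi.single 2 1) A))
    (by simp [rotCurve_zero, rotate_one]) (d := 0) (by
      simp only [h]
      exact hasDerivAt_const _ _)
  have hs : (((Pi.single 2 1 : Fin 3 → ℝ) ⨯₃ m, infRotate (Pi.single 2 1) A) : Phase) =
      ((Pi.single 2 1 : Fin 3 → ℝ) ⨯₃ m, 0) + (0, infRotate (Pi.single 2 1) A) := by simp
  rw [hs, map_add, fderiv_momentum] at hd
  rw [bracket, gradM_J3, fderiv_J3, triple_product_permutation]
  simpa using hd

end Brackets

/-! ### Involution and generic independence -/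

section Integrability

variable {γ₁ γ₂ γ₃ ε : ℝ}

theorem mem_regularSet (hε : ε = 1 ∨ ε = -1) (h₁ : 0 < γ₁) (h₂₃ : 0 ≤ γ₂ + γ₃)
    {A : OrderParam} (hA : A ∈ phaseOrbit (omega8 ε)) (m : Fin 3 → ℝ) :
    (m, A) ∈ regularSet γ₁ γ₂ γ₃ :=
  (inertia_det_isUnit hε h₁ h₂₃ hA).ne_zero

theorem differentiableAt_of_regular {F : Type*} [NormedAddCommGroup F] [NormedSpace ℝ F]
    {f : Phase → F} (hf : ContDiffOn ℝ ∞ f (regularSet γ₁ γ₂ γ₃)) {p : Phase}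
    (hp : p ∈ regularSet γ₁ γ₂ γ₃) : DifferentiableAt ℝ f p :=
  (hf.contDiffAt (isOpen_regularSet.mem_nhds hp)).differentiableAt (by simp)

theorem velocity_add_smul (m u : Fin 3 → ℝ) (A : OrderParam) (t : ℝ) :
    velocity γ₁ γ₂ γ₃ (m + t • u, A) =
      velocity γ₁ γ₂ γ₃ (m, A) + t • velocity γ₁ γ₂ γ₃ (u, A) := by
  simp only [velocity, Matrix.mulVec_add, Matrix.mulVec_smul, smul_add]
  rw [smul_comm]

theorem gradM_hamiltonian {m : Fin 3 → ℝ} {A : OrderParam}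
    (hp : (m, A) ∈ regularSet γ₁ γ₂ γ₃) :
    gradM (hamiltonian γ₁ γ₂ γ₃) (m, A) = velocity γ₁ γ₂ γ₃ (m, A) := by
  refine gradM_eq (differentiableAt_of_regular contDiffOn_hamiltonian hp) fun u => ?_
  have hs : m ⬝ᵥ velocity γ₁ γ₂ γ₃ (u, A) = u ⬝ᵥ velocity γ₁ γ₂ γ₃ (m, A) := by
    simp only [velocity, dotProduct_smul, inv_inertia_comm _ _ _ A m u]
  have he : (fun t : ℝ => hamiltonian γ₁ γ₂ γ₃ (m + t • u, A)) = fun t =>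
      hamiltonian γ₁ γ₂ γ₃ (m, A) + t * (velocity γ₁ γ₂ γ₃ (m, A) ⬝ᵥ u) +
        t ^ 2 * hamiltonian γ₁ γ₂ γ₃ (u, A) := by
    funext t
    simp only [hamiltonian_eq, velocity_add_smul, dotProduct_add, add_dotProduct, smul_dotProduct,
      dotProduct_smul, smul_eq_mul, hs, dotProduct_comm (velocity γ₁ γ₂ γ₃ (m, A)) u]
    ring
  rw [he]
  have h := hasDerivAt_quotient (hamiltonian γ₁ γ₂ γ₃ (m, A)) (velocity γ₁ γ₂ γ₃ (m, A) ⬝ᵥ u)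
    (hamiltonian γ₁ γ₂ γ₃ (u, A)) 0
  simpa using h

/-- The formula `jm_eq` holds only over the orbit, but lines in m keep A fixed, so it determines
this partial gradient. -/
theorem gradM_jm (hε : ε = 1 ∨ ε = -1) (h₁ : 0 < γ₁) (h₂₃ : 0 ≤ γ₂ + γ₃)
    {A : OrderParam} (hA : A ∈ phaseOrbit (omega8 ε)) (m : Fin 3 → ℝ) :
    gradM (jm γ₁ γ₂ γ₃) (m, A) = -ε • axis ε A := by
  refine gradM_eq (differentiableAt_of_regular contDiffOn_jm
    (mem_regularSet hε h₁ h₂₃ hA m)) fun u => ?_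
  have he : (fun t : ℝ => jm γ₁ γ₂ γ₃ (m + t • u, A)) = fun t =>
      -ε * (m ⬝ᵥ axis ε A) + t * ((-ε • axis ε A) ⬝ᵥ u) := by
    funext t
    simp only [jm_eq hε h₁ h₂₃ hA, add_dotProduct, smul_dotProduct, smul_eq_mul,
      dotProduct_comm u]
    ring
  rw [he]
  simpa using ((hasDerivAt_id (0 : ℝ)).mul_const ((-ε • axis ε A) ⬝ᵥ u)).const_add
    (-ε * (m ⬝ᵥ axis ε A))

theorem hasDerivAt_axis (hε : ε = 1 ∨ ε = -1) {A : OrderParam}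
    (hA : A ∈ phaseOrbit (omega8 ε)) (w : Fin 3 → ℝ) :
    HasDerivAt (fun t => axis ε (rotate (rotCurve w t) A)) (w ⨯₃ axis ε A) 0 := by
  simp only [axis_rotate hε hA]
  exact hasDerivAt_rotCurve_mulVec w _

theorem fderiv_jm_infRotate (hε : ε = 1 ∨ ε = -1) (h₁ : 0 < γ₁) (h₂₃ : 0 ≤ γ₂ + γ₃)
    {A : OrderParam} (hA : A ∈ phaseOrbit (omega8 ε)) (m w : Fin 3 → ℝ) :
    fderiv ℝ (jm γ₁ γ₂ γ₃) (m, A) (0, infRotate w A) = -ε * (m ⬝ᵥ (w ⨯₃ axis ε A)) := by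
  refine fderiv_eq_of_hasDerivAt_comp (differentiableAt_of_regular contDiffOn_jm
    (mem_regularSet hε h₁ h₂₃ hA m)) (hasDerivAt_rotation_curve m w A)
    (by simp [rotCurve_zero, rotate_one]) ?_
  simp only [jm_eq hε h₁ h₂₃ (rotate_mem hε hA _)]
  refine HasDerivAt.const_mul _ ?_
  exact HasDerivAt.fun_sum fun i _ => (hasDerivAt_pi.1 (hasDerivAt_axis hε hA w) i).const_mul (m i)

/-- The middle term is the derivative of h along the phase action, hence zero; the other two, m·(w ×
(-εx)) and the derivative of j_m under rotation by w, cancel. -/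
theorem bracket_hamiltonian_jm (hε : ε = 1 ∨ ε = -1) (h₁ : 0 < γ₁) (h₂₃ : 0 ≤ γ₂ + γ₃)
    {A : OrderParam} (hA : A ∈ phaseOrbit (omega8 ε)) (m : Fin 3 → ℝ) :
    bracket (hamiltonian γ₁ γ₂ γ₃) (jm γ₁ γ₂ γ₃) (m, A) = 0 := by
  have hd : fderiv ℝ (hamiltonian γ₁ γ₂ γ₃) (m, A) (0, infRotate (-ε • axis ε A) A) = 0 := by
    refine fderiv_eq_of_hasDerivAt_comp (differentiableAt_of_regular contDiffOn_hamiltonian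
      (mem_regularSet hε h₁ h₂₃ hA m)) ((hasDerivAt_const (0 : ℝ) m).prodMk
        (hasDerivAt_phaseShift hε hA)) (by simp [phaseShift_zero]) ?_
    simp only [hamiltonian_phaseShift]
    exact hasDerivAt_const _ _
  rw [bracket, gradM_jm hε h₁ h₂₃ hA, hd, fderiv_jm_infRotate hε h₁ h₂₃ hA]
  simp

theorem bracket_hamiltonian_J3 (hε : ε = 1 ∨ ε = -1) (h₁ : 0 < γ₁) (h₂₃ : 0 ≤ γ₂ + γ₃)
    {A : OrderParam} (hA : A ∈ phaseOrbit (omega8 ε)) (m : Fin 3 → ℝ) :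
    bracket (hamiltonian γ₁ γ₂ γ₃) J3 (m, A) = 0 :=
  bracket_J3_eq_zero (differentiableAt_of_regular contDiffOn_hamiltonian
    (mem_regularSet hε h₁ h₂₃ hA m)) fun t =>
      hamiltonian_rotate (Gam_comm_rotCurve γ₁ γ₂ γ₃ t) m A

theorem bracket_jm_J3 (hε : ε = 1 ∨ ε = -1) (h₁ : 0 < γ₁) (h₂₃ : 0 ≤ γ₂ + γ₃)
    {A : OrderParam} (hA : A ∈ phaseOrbit (omega8 ε)) (m : Fin 3 → ℝ) :
    bracket (jm γ₁ γ₂ γ₃) J3 (m, A) = 0 :=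
  bracket_J3_eq_zero (differentiableAt_of_regular contDiffOn_jm
    (mem_regularSet hε h₁ h₂₃ hA m)) fun t => jm_rotate (Gam_comm_rotCurve γ₁ γ₂ γ₃ t) m A

/-- The triple product of the momentum gradients of `h`, `jm` and `J₃`, up to sign. -/
noncomputable def gradientVolume (γ₁ γ₂ γ₃ ε : ℝ) (p : Phase) : ℝ :=
  velocity γ₁ γ₂ γ₃ p ⬝ᵥ (axis ε p.2 ⨯₃ Pi.single 2 1)

theorem contDiffOn_gradientVolume :
    ContDiffOn ℝ ∞ (gradientVolume γ₁ γ₂ γ₃ ε) (regularSet γ₁ γ₂ γ₃) := by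
  refine contDiffOn_velocity.dotProduct (contDiffOn_pi.2 fun i => ?_)
  have h : ∀ i, ContDiffOn ℝ ∞ (fun p : Phase => axis ε p.2 i) (regularSet γ₁ γ₂ γ₃) := fun i =>
    ((contDiff_pi.1 (contDiff_axis ε) i).comp contDiff_snd).contDiffOn
  have h0 := h 0
  have h1 := h 1
  have h2 := h 2
  fin_cases i <;> simp [cross_apply] <;> fun_prop

theorem fderiv_gradientVolume {m : Fin 3 → ℝ} {A : OrderParam}
    (hp : (m, A) ∈ regularSet γ₁ γ₂ γ₃) (u : Fin 3 → ℝ) :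
    fderiv ℝ (gradientVolume γ₁ γ₂ γ₃ ε) (m, A) (u, 0) =
      velocity γ₁ γ₂ γ₃ (u, A) ⬝ᵥ (axis ε A ⨯₃ Pi.single 2 1) := by
  refine fderiv_eq_of_hasDerivAt_comp (differentiableAt_of_regular contDiffOn_gradientVolume hp)
    (hasDerivAt_momentum_line m u A) (by simp) ?_
  simp only [gradientVolume, velocity_add_smul, add_dotProduct, smul_dotProduct, smul_eq_mul]
  simpa using ((hasDerivAt_id (0 : ℝ)).mul_const
    (velocity γ₁ γ₂ γ₃ (u, A) ⬝ᵥ (axis ε A ⨯₃ Pi.single 2 1))).const_add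
      (velocity γ₁ γ₂ γ₃ (m, A) ⬝ᵥ (axis ε A ⨯₃ Pi.single 2 1))

/-- Cramer's rule: pairing the relation with y × z, z × x or x × y isolates one coefficient. -/
theorem eq_zero_of_triple_product_ne_zero {x y z : Fin 3 → ℝ} (h : x ⬝ᵥ (y ⨯₃ z) ≠ 0) {a b c : ℝ}
    (h0 : a • x + b • y + c • z = 0) : a = 0 ∧ b = 0 ∧ c = 0 := by
  have e0 := congrFun h0 0
  have e1 := congrFun h0 1
  have e2 := congrFun h0 2
  simp [cross_apply, dotProduct, Fin.sum_univ_three] at e0 e1 e2 h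
  refine ⟨?_, ?_, ?_⟩
  · refine (mul_eq_zero.1 ?_).resolve_right h
    linear_combination (y 1 * z 2 - y 2 * z 1) * e0 + (y 2 * z 0 - y 0 * z 2) * e1 +
      (y 0 * z 1 - y 1 * z 0) * e2
  · refine (mul_eq_zero.1 ?_).resolve_right h
    linear_combination (z 1 * x 2 - z 2 * x 1) * e0 + (z 2 * x 0 - z 0 * x 2) * e1 +
      (z 0 * x 1 - z 1 * x 0) * e2
  · refine (mul_eq_zero.1 ?_).resolve_right h
    linear_combination (x 1 * y 2 - x 2 * y 1) * e0 + (x 2 * y 0 - x 0 * y 2) * e1 +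
      (x 0 * y 1 - x 1 * y 0) * e2

/-- Differentials of the restricted integrals are independent where `gradientVolume` does not
vanish. -/
theorem linearIndependent_differentials (hε : ε = 1 ∨ ε = -1) (h₁ : 0 < γ₁) (h₂₃ : 0 ≤ γ₂ + γ₃)
    {k : ℕ} {V : Set (Fin k → ℝ)} {φ : (Fin k → ℝ) → Phase}
    (hφ : IsLocalParam (Set.univ ×ˢ phaseOrbit (omega8 ε)) V φ) {v : Fin k → ℝ} (hv : v ∈ V)
    (hF : gradientVolume γ₁ γ₂ γ₃ ε (φ v) ≠ 0) :
    LinearIndependent ℝ fun i : Fin 3 => fderiv ℝ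
      (fun u => (![hamiltonian γ₁ γ₂ γ₃, jm γ₁ γ₂ γ₃, J3] : Fin 3 → Phase → ℝ) i (φ u)) v := by
  set f : Fin 3 → Phase → ℝ := ![hamiltonian γ₁ γ₂ γ₃, jm γ₁ γ₂ γ₃, J3] with hf
  have hA : (φ v).2 ∈ phaseOrbit (omega8 ε) := (hφ.mem hv).2
  obtain ⟨m, A, hmA⟩ : ∃ m A, φ v = (m, A) := ⟨_, _, rfl⟩
  rw [hmA] at hA hF
  have hreg := mem_regularSet hε h₁ h₂₃ hA m
  have hfd : ∀ i, DifferentiableAt ℝ (f i) (φ v) := by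
    intro i
    rw [hmA]
    fin_cases i
    · exact differentiableAt_of_regular contDiffOn_hamiltonian hreg
    · exact differentiableAt_of_regular contDiffOn_jm hreg
    · exact contDiff_J3.differentiable (by simp) _
  rw [Fintype.linearIndependent_iff]
  intro c hc
  -- Every (u, 0) is tangent to the orbit, since its momentum factor is all of ℝ³. A relation
  -- between restricted differentials therefore passes to the full m-gradients.
  have hsum : ∑ i, c i • gradM (f i) (m, A) = 0 := by
    refine dotProduct_eq_zero_iff.1 fun u => ?_
    obtain ⟨ξ, hξ⟩ : ∃ ξ, fderiv ℝ φ v ξ = (u, 0) := hφ.exists_fderiv_eq hv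
      (hasDerivAt_momentum_line m u A) (by simp [hmA]) fun t => ⟨Set.mem_univ _, hA⟩
    have h := congrArg (fun L => L ξ) hc
    have hcomp : ∀ i, fderiv ℝ (fun u => f i (φ u)) v = (fderiv ℝ (f i) (φ v)).comp
        (fderiv ℝ φ v) := fun i => fderiv_comp v (hfd i) (hφ.differentiableAt hv)
    simp only [hcomp, sum_apply, smul_apply, zero_apply,
      ContinuousLinearMap.comp_apply, hξ, hmA, fderiv_momentum] at h
    simpa only [sum_dotProduct, smul_dotProduct] using h
  rw [Fin.sum_univ_three] at hsum
  simp only [hf, Matrix.cons_val_zero, Matrix.cons_val_one, Matrix.cons_val_two, Matrix.head_cons,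
    Matrix.tail_cons, gradM_hamiltonian hreg, gradM_jm hε h₁ h₂₃ hA, gradM_J3] at hsum
  rw [smul_smul] at hsum
  obtain ⟨h0, h1, h2⟩ := eq_zero_of_triple_product_ne_zero hF hsum
  have hε0 : -ε ≠ 0 := by rcases hε with rfl | rfl <;> norm_num
  intro i
  fin_cases i
  exacts [h0, (mul_eq_zero.1 h1).resolve_right hε0, h2]

theorem volume_dependent_eq_zero (hε : ε = 1 ∨ ε = -1) (h₁ : 0 < γ₁) (h₂₃ : 0 ≤ γ₂ + γ₃)
    {k : ℕ} {V : Set (Fin k → ℝ)} {φ : (Fin k → ℝ) → Phase}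
    (hφ : IsLocalParam (Set.univ ×ˢ phaseOrbit (omega8 ε)) V φ) :
    MeasureTheory.volume {v ∈ V | ¬ LinearIndependent ℝ fun i : Fin 3 => fderiv ℝ
      (fun u => (![hamiltonian γ₁ γ₂ γ₃, jm γ₁ γ₂ γ₃, J3] : Fin 3 → Phase → ℝ) i (φ u)) v} = 0 := by
  have hA : ∀ v ∈ V, (φ v).2 ∈ phaseOrbit (omega8 ε) := fun v hv => (hφ.mem hv).2
  have hreg : ∀ v ∈ V, φ v ∈ regularSet γ₁ γ₂ γ₃ := fun v hv =>
    mem_regularSet hε h₁ h₂₃ (hA v hv) (φ v).1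
  have hFd : ∀ v ∈ V, DifferentiableAt ℝ (gradientVolume γ₁ γ₂ γ₃ ε) (φ v) := fun v hv =>
    differentiableAt_of_regular contDiffOn_gradientVolume (hreg v hv)
  have hGd : Differentiable ℝ fun p : Phase => axis ε p.2 0 :=
    ((contDiff_pi.1 (contDiff_axis ε) 0).comp contDiff_snd).differentiable (by simp)
  have hF := volume_zeros_fderiv_ne_zero hφ.1 (g := fun v => gradientVolume γ₁ γ₂ γ₃ ε (φ v))
    fun v hv => (hFd v hv).comp v (hφ.differentiableAt hv)
  have hG := volume_zeros_fderiv_ne_zero hφ.1 (g := fun v => axis ε (φ v).2 0)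
    fun v hv => (hGd (φ v)).comp v (hφ.differentiableAt hv)
  refine MeasureTheory.measure_mono_null ?_ (MeasureTheory.measure_union_null hF hG)
  rintro v ⟨hv, hdep⟩
  have hF0 : gradientVolume γ₁ γ₂ γ₃ ε (φ v) = 0 := by
    by_contra h
    exact hdep (linearIndependent_differentials hε h₁ h₂₃ hφ hv h)
  -- Either v is a regular zero of F, or dF = 0; in the latter case v will be a regular zero of x₀.
  by_cases hdF : fderiv ℝ (fun v => gradientVolume γ₁ γ₂ γ₃ ε (φ v)) v = 0
  swap
  · exact Or.inl ⟨hv, hF0, hdF⟩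
  refine Or.inr ⟨hv, ?_⟩
  have hAv := hA v hv
  have hregv := hreg v hv
  obtain ⟨m, A, hmA⟩ : ∃ m A, φ v = (m, A) := ⟨_, _, rfl⟩
  rw [hmA] at hAv hregv
  simp only [hmA]
  set y := axis ε A ⨯₃ Pi.single 2 1 with hy
  have hy0 : y ⬝ᵥ y = 0 := by
    -- The momentum Jy has velocity y/2, so the derivative of F in this direction is |y|²/2; its
    -- vanishing forces x × e₃ = 0.
    obtain ⟨ξ, hξ⟩ : ∃ ξ, fderiv ℝ φ v ξ = (inertia γ₁ γ₂ γ₃ A *ᵥ y, 0) :=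
      hφ.exists_fderiv_eq hv (hasDerivAt_momentum_line m (inertia γ₁ γ₂ γ₃ A *ᵥ y) A)
      (by simp [hmA]) fun t => ⟨Set.mem_univ _, hAv⟩
    have hc : fderiv ℝ (fun v => gradientVolume γ₁ γ₂ γ₃ ε (φ v)) v =
        (fderiv ℝ (gradientVolume γ₁ γ₂ γ₃ ε) (φ v)).comp (fderiv ℝ φ v) :=
      fderiv_comp v (hFd v hv) (hφ.differentiableAt hv)
    have h := congrArg (fun L => L ξ) (hc.symm.trans hdF)
    simp only [ContinuousLinearMap.comp_apply, hξ, hmA, fderiv_gradientVolume hregv,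
      velocity, Matrix.mulVec_mulVec, Matrix.nonsing_inv_mul _ (isUnit_iff_ne_zero.2 hregv),
      Matrix.one_mulVec, smul_dotProduct, smul_eq_mul, zero_apply] at h
    linarith
  have hy1 : y = 0 := dotProduct_self_eq_zero.1 hy0
  have hx0 : axis ε A 0 = 0 := by simpa [hy, cross_apply] using congrFun hy1 1
  have hx1 : axis ε A 1 = 0 := by simpa [hy, cross_apply] using congrFun hy1 0
  refine ⟨hx0, fun hdG => ?_⟩
  -- Rotating about e₂ changes x₀ at rate x₂. If this also vanished, x would be zero, although |x| =
  -- 1.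
  obtain ⟨ξ, hξ⟩ : ∃ ξ, fderiv ℝ φ v ξ = (0, infRotate (Pi.single 1 1) A) :=
    hφ.exists_fderiv_eq hv (hasDerivAt_rotation_curve m (Pi.single 1 1) A)
    (by simp [hmA, rotCurve_zero, rotate_one]) fun t => ⟨Set.mem_univ _, rotate_mem hε hAv _⟩
  have hc : fderiv ℝ (fun v => axis ε (φ v).2 0) v =
      (fderiv ℝ (fun p : Phase => axis ε p.2 0) (φ v)).comp (fderiv ℝ φ v) :=
    fderiv_comp v (hGd (φ v)) (hφ.differentiableAt hv)
  have h := congrArg (fun L => L ξ) (hc.symm.trans hdG)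
  have hd : fderiv ℝ (fun p : Phase => axis ε p.2 0) (m, A) (0, infRotate (Pi.single 1 1) A) =
      axis ε A 2 := by
    refine fderiv_eq_of_hasDerivAt_comp (hGd _) (hasDerivAt_rotation_curve m (Pi.single 1 1) A)
      (by simp [rotCurve_zero, rotate_one]) ?_
    have := hasDerivAt_pi.1 (hasDerivAt_axis hε hAv (Pi.single 1 1)) 0
    simpa [cross_apply] using this
  simp only [ContinuousLinearMap.comp_apply, hξ, hmA, hd, zero_apply] at h
  have hn := axis_dotProduct_self hε hAv
  simp [dotProduct, Fin.sum_univ_three, hx0, hx1, h] at hn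

theorem isCompletelyIntegrable (hε : ε = 1 ∨ ε = -1) (h₁ : 0 < γ₁) (h₂₃ : 0 ≤ γ₂ + γ₃)
    (μ : Fin 3 → ℝ) : IsCompletelyIntegrable (coadjointOrbit (μ, omega8 ε))
      ![hamiltonian γ₁ γ₂ γ₃, jm γ₁ γ₂ γ₃, J3] where
  orbit := ⟨_, rfl⟩
  dim := by
    rw [coadjointOrbit_eq hε]
    exact isSmoothSubmanifold_prod hε
  smooth := by
    rw [coadjointOrbit_eq hε]
    refine ⟨regularSet γ₁ γ₂ γ₃, isOpen_regularSet, fun p hp => mem_regularSet hε h₁ h₂₃ hp.2 p.1,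
      fun i => ?_⟩
    fin_cases i
    exacts [contDiffOn_hamiltonian, contDiffOn_jm, contDiff_J3.contDiffOn]
  involution := by
    rw [coadjointOrbit_eq hε]
    rintro i j ⟨m, A⟩ ⟨-, hA⟩
    have h01 := bracket_hamiltonian_jm hε h₁ h₂₃ hA m
    have h02 := bracket_hamiltonian_J3 hε h₁ h₂₃ hA m
    have h12 := bracket_jm_J3 hε h₁ h₂₃ hA m
    have h10 := (bracket_swap (jm γ₁ γ₂ γ₃) _ _).trans (neg_eq_zero.2 h01)
    have h20 := (bracket_swap J3 _ _).trans (neg_eq_zero.2 h02)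
    have h21 := (bracket_swap J3 _ _).trans (neg_eq_zero.2 h12)
    fin_cases i <;> fin_cases j
    exacts [bracket_self _ _, h01, h02, h10, bracket_self _ _, h12, h20, h21, bracket_self _ _]
  independent := by
    rw [coadjointOrbit_eq hε]
    exact fun V φ hφ => volume_dependent_eq_zero hε h₁ h₂₃ hφ

end Integrability

end NeutronStar

theorem theorem4p12 (γ₁ γ₂ γ₃ : ℝ) (hγ₁ : 0 < γ₁) (hγ₂ : 0 < γ₂) (hγ₃ : 0 < γ₃)
    (ε : ℝ) (hε : ε = 1 ∨ ε = -1) (μ : Fin 3 → ℝ) :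
    (∃ φ : Matrix (Fin 3) (Fin 3) ℝ → OrderParam,
      (∀ R : SO3, φ R.1 = rotate R (omega8 ε)) ∧
      IsDiffeoOn φ (Matrix.specialOrthogonalGroup (Fin 3) ℝ : Set (Matrix (Fin 3) (Fin 3) ℝ))
        (phaseOrbit (omega8 ε))) ∧
    coadjointOrbit (μ, omega8 ε) = Set.univ ×ˢ phaseOrbit (omega8 ε) ∧
    IsSmoothSubmanifold 6 (coadjointOrbit (μ, omega8 ε)) ∧
    (∀ A ∈ phaseOrbit (omega8 ε), IsUnit (inertia γ₁ γ₂ γ₃ A).det) ∧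
    IsCompletelyIntegrable (coadjointOrbit (μ, omega8 ε))
      ![hamiltonian γ₁ γ₂ γ₃, jm γ₁ γ₂ γ₃, J3] := by
  have h₂₃ : 0 ≤ γ₂ + γ₃ := (add_pos hγ₂ hγ₃).le
  have hint := isCompletelyIntegrable hε hγ₁ h₂₃ μ
  exact ⟨isDiffeoOn_rotate hε, coadjointOrbit_eq hε μ, hint.dim,
    fun A hA => inertia_det_isUnit hε hγ₁ h₂₃ hA, hint⟩
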